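/- Let $d\ge 2$. A Fano simplex of dimension $d$ is a full-dimensional simplex $\Delta\subseteq\mathbb{R}^d$ whose vertices are primitive points of the lattice $\mathbb{Z}^d$ and which contains the origin in its interior. Its dual is $\Delta^*=\{u\in\mathbb{R}^d : \langle u,v\rangle\ge -1 \text{ for all } v\in\Delta\}$, and its Gorenstein index is the smallest positive integer $g$ such that $g\Delta^*$ is a lattice simplex, i.e. has all its vertices in $\mathbb{Z}^d$. Its normalized volume is $\mathrm{Vol}(\Delta)=d!\,\mathrm{vol}(\Delta)$, where $\mathrm{vol}$ is the euclidean volume. We write $\Delta\cong\Delta'$ if some lattice isomorphism (extended linearly) maps $\Delta$ onto $\Delta'$; thus isomorphic simplices have the same dimension. For a $d\times(d+1)$ matrix $P$ let $\Delta(P)$ be the convex hull of its columns. For integers $g\ge1$, $k\ge 1$ put $$s_{g,1}=g+1,\qquad s_{g,k+1}=s_{g,k}(s_{g,k}-1)+1,\qquad t_{g,k}=s_{g,k}-1 .$$ Let $\Delta$ be a Fano simplex of dimension $d\ge2$ and Gorenstein index $g$. (i) If $(d,g)=(2,1)$, then $\mathrm{Vol}(\Delta)\le 9$, and equality holds if and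 only if $\Delta\cong\Delta(P)$ with $$P=\begin{bmatrix}1&1&-2\\0&3&-3\end{bmatrix}.$$ (ii) If $(d,g)\ne(2,1)$, then $$\mathrm{Vol}(\Delta)\le\frac{2\,t_{g,d}^2}{g^2},$$ and equality holds if and only if $\Delta\cong\Delta(P)$ where $P$ is one of the following two matrices: $$\begin{bmatrix}1&1&1&-5\\0&2&2&-4\\0&0&6&-6\end{bmatrix}$$ or the $d\times(d+1)$ matrix with columns $e_1,\dots,e_{d-1},v,w$, where $e_1,\dots,e_{d-1}$ are the first $d-1$ standard basis vectors, $$v_k=\frac{s_{g,k}-g}{s_{g,k}}\,\frac{t_{g,d}}{g},\qquad w_k=-\frac{s_{g,k}+g}{s_{g,k}}\,\frac{t_{g,d}}{g}\qquad(1\le k\le d-1),\qquad v_d=\frac{t_{g,d}}{g},\qquad w_d=-\frac{t_{g,d}}{g}.$$ These bounds are sharp for all $d\ge 2$ and $g\ge1$: the simplex $\Delta(P)$ in (i) is a Fano simplex of Gorenstein index $1$, for every $(d,g)\neq(2,1)$ with $d\ge2$, $g\ge1$ the last simplex in (ii) is a Fano simplex of dimension $d$ and Gorenstein index $g$, and the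 first simplex in (ii) is a three-dimensional Fano simplex of Gorenstein index $1$ (so it occurs only for $(d,g)=(3,1)$). -/

import Mathlib

open scoped Pointwise

/-! Lattice simplices in `ℝ^d` with respect to the standard lattice `ℤ^d`.  The dual lattice is
identified with `ℤ^d` through the standard scalar product. -/

/-- The simplex (convex hull) whose vertices are the columns of a `d × (d+1)` matrix. -/
def simplexOf {d : ℕ} (P : Matrix (Fin d) (Fin (d + 1)) ℝ) : Set (Fin d → ℝ) :=
  convexHull ℝ (Set.range fun (j : Fin (d + 1)) (i : Fin d) => P i j)

/-- An integral matrix, read as a real matrix. -/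
def toRealMatrix {m n : ℕ} (P : Matrix (Fin m) (Fin n) ℤ) : Matrix (Fin m) (Fin n) ℝ :=
  P.map fun a => (a : ℝ)

/-- The columns of `P` are affinely independent, so `simplexOf P` is a full-dimensional simplex
whose vertices are exactly the columns of `P`. -/
def Nondegenerate {d : ℕ} (P : Matrix (Fin d) (Fin (d + 1)) ℝ) : Prop :=
  AffineIndependent ℝ fun (j : Fin (d + 1)) (i : Fin d) => P i j

/-- A full-dimensional simplex all of whose vertices are lattice points. -/
def IsLatticeSimplex {d : ℕ} (S : Set (Fin d → ℝ)) : Prop :=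
  ∃ P : Matrix (Fin d) (Fin (d + 1)) ℤ,
    Nondegenerate (toRealMatrix P) ∧ S = simplexOf (toRealMatrix P)

/-- A primitive lattice point: it is not an integral multiple `k • w` of a lattice point `w`
unless `k = 1` or `k = -1` (in particular it is not zero). -/
def IsPrimitivePoint {d : ℕ} (v : Fin d → ℤ) : Prop :=
  ∀ (k : ℤ) (w : Fin d → ℤ), v = k • w → IsUnit k

/-- A Fano simplex: a full-dimensional lattice simplex with primitive vertices that contains the
origin in its interior. -/
def IsFanoSimplex {d : ℕ} (S : Set (Fin d → ℝ)) : Prop :=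
  ∃ P : Matrix (Fin d) (Fin (d + 1)) ℤ,
    Nondegenerate (toRealMatrix P) ∧
    (∀ j : Fin (d + 1), IsPrimitivePoint fun i => P i j) ∧
    S = simplexOf (toRealMatrix P) ∧
    (0 : Fin d → ℝ) ∈ interior S

/-- The dual `{u | ⟨u, v⟩ ≥ -1 for all v ∈ S}`. -/
def dualPolytope {d : ℕ} (S : Set (Fin d → ℝ)) : Set (Fin d → ℝ) :=
  {u | ∀ v ∈ S, -1 ≤ u ⬝ᵥ v}

/-- The index of rationality: the smallest positive integer `k` such that `k S` is a lattice
simplex. -/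
noncomputable def rationalityIndex {d : ℕ} (S : Set (Fin d → ℝ)) : ℕ :=
  sInf {k : ℕ | 1 ≤ k ∧ IsLatticeSimplex ((k : ℝ) • S)}

/-- The Gorenstein index.  For a lattice simplex `S` the first factor is one, so this is the
smallest positive integer `g` such that the `g`-fold of the dual of `S` is a lattice simplex. -/
noncomputable def gorensteinIndex {d : ℕ} (S : Set (Fin d → ℝ)) : ℕ :=
  rationalityIndex S * rationalityIndex (dualPolytope S)

/-- The normalized volume: `d!` times the euclidean volume. -/
noncomputable def normalizedVolume {d : ℕ} (S : Set (Fin d → ℝ)) : ℝ :=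
  (d.factorial : ℝ) * (MeasureTheory.volume S).toReal

/-- `S` and `T` are isomorphic: some isomorphism of the lattices `ℤ^d → ℤ^e`, extended to a
real linear map, maps `S` onto `T`. -/
def LatticeIso {d e : ℕ} (S : Set (Fin d → ℝ)) (T : Set (Fin e → ℝ)) : Prop :=
  ∃ φ : (Fin d → ℤ) ≃ₗ[ℤ] (Fin e → ℤ),
    (fun x : Fin d → ℝ =>
      (toRealMatrix (LinearMap.toMatrix' (φ : (Fin d → ℤ) →ₗ[ℤ] (Fin e → ℤ)))).mulVec x) '' S = T

/-- The `g`-Sylvester sequence `s_{g,1}, s_{g,2}, …` (the value at index `0` is not used). -/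
def sylvester (g : ℕ) : ℕ → ℤ
  | 0 => 0
  | 1 => (g : ℤ) + 1
  | k + 2 => sylvester g (k + 1) * (sylvester g (k + 1) - 1) + 1

/-- The truncated `g`-Sylvester sequence `t_{g,k} = s_{g,k} - 1` for `k ≥ 1`. -/
def truncSylvester (g k : ℕ) : ℤ := sylvester g k - 1

/-- The extremal triangle of Gorenstein index one. -/
def extremalTriangle : Matrix (Fin 2) (Fin 3) ℝ :=
  !![1, 1, -2;
     0, 3, -3]

/-- The sporadic extremal tetrahedron of Gorenstein index one. -/
def extremalTetrahedron : Matrix (Fin 3) (Fin 4) ℝ :=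
  !![1, 1, 1, -5;
     0, 2, 2, -4;
     0, 0, 6, -6]

/-- The general extremal matrix (for `d ≥ 2` and `g ≥ 1`).  Its first `d - 1` columns are the
standard basis vectors `e_1, …, e_{d-1}`; the last two columns have `k`-th entries
`((s_{g,k} - g) / s_{g,k}) (t_{g,d} / g)` and `-((s_{g,k} + g) / s_{g,k}) (t_{g,d} / g)`
for `1 ≤ k ≤ d - 1`, and `d`-th entries `t_{g,d} / g` and `-t_{g,d} / g`.
Rows and columns are numbered from zero in the code, so that row `i` carries `s_{g,i+1}`. -/
noncomputable def extremalMatrix (d g : ℕ) : Matrix (Fin d) (Fin (d + 1)) ℝ :=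
  Matrix.of fun i j =>
    let s : ℝ := (sylvester g ((i : ℕ) + 1) : ℝ)
    let t : ℝ := (truncSylvester g d : ℝ)
    if (j : ℕ) + 1 < d then
      (if (i : ℕ) = (j : ℕ) then 1 else 0)
    else if (j : ℕ) + 1 = d then
      (if (i : ℕ) + 1 = d then t / g else ((s - g) / s) * (t / g))
    else
      (if (i : ℕ) + 1 = d then -(t / g) else -(((s + g) / s) * (t / g)))

/-! Let v_0, …, v_d be the vertices of Δ and u_0, …, u_d those of gΔ*, which are integral. Then
⟨u_i, v_j⟩ = -g for i ≠ j and ⟨u_i, v_i⟩ = A_i - g with positive integers A_i (`IsDualPair`).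
Bordering the two vertex matrices turns this into a matrix product equal to diag(A). It yields the
unit fraction partition ∑ 1/A_i = 1/g and, on determinants, g · D · Vol(Δ) = ∏ A_i, where D is the
normalized volume of gΔ*. Since v_i is primitive, A_i divides D (`IsDualPair.dvd_det`). With A
sorted increasingly this gives Vol(Δ) ≤ A_0 ⋯ A_{d-1} / g (`IsDualPair.sq_mul_abs_det_le`).

It remains to maximise A_0 ⋯ A_{d-1} over unit fraction partitions of 1/g. Every remainder 1/g -
∑_{k<i} 1/A_k is positive with a denominator dividing g A_0 ⋯ A_{i-1}, hence at least 1/(g A_0 ⋯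
A_{i-1}); the Sylvester sequence attains this for all i. A smoothing and majorization argument
(`exists_block_le_prod`) bounds the product by that of a partition into m Sylvester terms followed
by j + 1 equal terms, m + j = d. The resulting candidates (j+1)^j t_{g,m+1}^(j+1) are compared in
`mul_prod_le_of_sum_inv_eq`: j = 1 wins, with a tie at j = 2 exactly when t_{g,d-1} = 2, that is for
(d, g) = (3, 1) or (2, 2). The case (2, 1), where j = 2 beats j = 1, is treated by hand.

Equality forces the partition to be extremal and D = A_d. The latter determines the vertices modulo
the A_j up to multiples of v_d (`IsDualPair.exists_dvd_sub`), enough to write V = B P with B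
integral and P the extremal matrix; equal volumes make B unimodular. The tie at (2, 2) is excluded
by a parity argument on primitive vertices. -/

/-! ### Lower bounds for products of decreasing sequences with controlled remainders. -/

open Finset in
/-- Abel summation with antitone weights and nonnegative partial sums. -/
theorem mul_sum_le_sum_mul_of_antitone {w l : ℕ → ℝ} {N : ℕ}
    (hw : ∀ i, i < N → w (i + 1) ≤ w i)
    (hS : ∀ i, i < N → 0 ≤ ∑ k ∈ range (i + 1), l k) :
    w N * ∑ k ∈ range (N + 1), l k ≤ ∑ k ∈ range (N + 1), w k * l k := by
  induction N with
  | zero => simp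
  | succ N ih =>
    have h1 := ih (fun i hi => hw i (by omega)) (fun i hi => hS i (by omega))
    have h2 := mul_le_mul_of_nonneg_right (hw N (by omega)) (hS N (by omega))
    rw [sum_range_succ l, sum_range_succ (fun k => w k * l k)]
    linarith

open Finset in
-- From log s ≤ s - 1, each x_k - y_k is at least y_k log (x_k / y_k). The weights y_k decrease and
-- the partial sums of the logarithms are positive, so Abel summation bounds the total below by y_N
-- times the full sum of logarithms. By e / j ≤ y_N and `hfin` this is at least -e log (f / e) ≥ e -
-- f. The number e acts as j equal entries e / j that continue the decreasing sequence.
theorem sum_lt_sum_of_prod_lt_prod {y x : ℕ → ℝ} {N j : ℕ} {e f : ℝ}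
    (hy : ∀ i, i ≤ N → 0 < y i) (hx : ∀ i, i ≤ N → 0 < x i) (he : 0 < e) (hf : 0 < f)
    (hj : 1 ≤ j) (hanti : ∀ i, i < N → y (i + 1) ≤ y i) (hlast : e / j ≤ y N)
    (hprod : ∀ i, i ≤ N → ∏ k ∈ range (i + 1), y k < ∏ k ∈ range (i + 1), x k)
    (hfin : (∏ k ∈ range (N + 1), y k) * e ^ j ≤ (∏ k ∈ range (N + 1), x k) * f ^ j) :
    ∑ k ∈ range (N + 1), y k + e < ∑ k ∈ range (N + 1), x k + f := by
  have hlog : ∀ a b : ℝ, 0 < a → 0 < b → a * Real.log (b / a) ≤ b - a := by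
    intro a b ha hb
    have := Real.log_le_sub_one_of_pos (div_pos hb ha)
    calc a * Real.log (b / a) ≤ a * (b / a - 1) := by gcongr
      _ = b - a := by field_simp
  have hyp : ∀ i, i ≤ N → 0 < ∏ k ∈ range (i + 1), y k := fun i hi =>
    prod_pos fun k hk => hy k (by have := mem_range.1 hk; omega)
  have hxp : ∀ i, i ≤ N → 0 < ∏ k ∈ range (i + 1), x k := fun i hi =>
    prod_pos fun k hk => hx k (by have := mem_range.1 hk; omega)
  have hsum : ∀ i, i ≤ N → ∑ k ∈ range (i + 1), Real.log (x k / y k) =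
      Real.log (∏ k ∈ range (i + 1), x k) - Real.log (∏ k ∈ range (i + 1), y k) := by
    intro i hi
    rw [Real.log_prod, Real.log_prod, ← sum_sub_distrib]
    · refine sum_congr rfl fun k hk => ?_
      have := mem_range.1 hk
      rw [Real.log_div (hx k (by omega)).ne' (hy k (by omega)).ne']
    · exact fun k hk => (hy k (by have := mem_range.1 hk; omega)).ne'
    · exact fun k hk => (hx k (by have := mem_range.1 hk; omega)).ne'
  have hS : ∀ i, i ≤ N → 0 < ∑ k ∈ range (i + 1), Real.log (x k / y k) := by
    intro i hi
    rw [hsum i hi, sub_pos]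
    exact Real.log_lt_log (hyp i hi) (hprod i hi)
  have habel := mul_sum_le_sum_mul_of_antitone (w := y) (l := fun k => Real.log (x k / y k))
    (N := N) hanti (fun i hi => (hS i (by omega)).le)
  have hlt : ∑ k ∈ range (N + 1), y k * Real.log (x k / y k) <
      ∑ k ∈ range (N + 1), (x k - y k) := by
    -- Strictness comes from the index 0, where the product condition reads y_0 < x_0.
    refine sum_lt_sum (fun k hk => ?_) ⟨0, by simp, ?_⟩
    · have := mem_range.1 hk
      exact hlog _ _ (hy k (by omega)) (hx k (by omega))
    · have h0 := hprod 0 (by omega)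
      simp only [zero_add, prod_range_one] at h0
      have hy0 := hy 0 (by omega)
      have hx0 := hx 0 (by omega)
      have hne : x 0 / y 0 ≠ 1 := by
        rw [Ne, div_eq_one_iff_eq hy0.ne']
        exact h0.ne'
      have := Real.log_lt_sub_one_of_pos (div_pos hx0 hy0) hne
      calc y 0 * Real.log (x 0 / y 0) < y 0 * (x 0 / y 0 - 1) := by gcongr
        _ = x 0 - y 0 := by field_simp
  have hef := hlog e f he hf
  have hjpos : (0 : ℝ) < j := by exact_mod_cast hj
  have hfinlog : 0 ≤ ∑ k ∈ range (N + 1), Real.log (x k / y k) + j * Real.log (f / e) := by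
    rw [hsum N le_rfl, Real.log_div hf.ne' he.ne']
    have := Real.log_le_log (mul_pos (hyp N le_rfl) (pow_pos he j)) hfin
    rw [Real.log_mul (hyp N le_rfl).ne' (pow_pos he j).ne',
      Real.log_mul (hxp N le_rfl).ne' (pow_pos hf j).ne', Real.log_pow, Real.log_pow] at this
    linarith
  have h3 := mul_le_mul_of_nonneg_right hlast (hS N le_rfl).le
  have h4 := mul_nonneg (div_pos he hjpos).le hfinlog
  have h5 : e / j * (j * Real.log (f / e)) = e * Real.log (f / e) := by field_simp
  rw [mul_add, h5] at h4
  rw [sum_sub_distrib] at hlt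
  linarith

open Finset in
-- Split at the last index m where the product of the x's does not exceed that of the y's. Up to m
-- the remainder conditions give ∑ y ≤ ∑ x. Beyond m the partial products of the x's are strictly
-- larger, so `sum_lt_sum_of_prod_lt_prod` would contradict the equality of the total sums in `hef`.
-- Hence m = n, and there f ≤ e and `hfin` leave only equality.
theorem prod_eq_and_eq_of_prod_mul_pow_le {y x : ℕ → ℝ} {c : ℝ} {n j : ℕ} {e f : ℝ} (hc : 0 < c)
    (hy : ∀ i, i < n → 0 < y i) (hx : ∀ i, i < n → 0 < x i) (he : 0 < e) (hf : 0 < f)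
    (hj : 1 ≤ j) (hanti : ∀ i, i + 1 < n → y (i + 1) ≤ y i) (hlast : ∀ i, i + 1 = n → e / j ≤ y i)
    (hres : ∀ i, i ≤ n → c * ∏ k ∈ range i, y k ≤ c - ∑ k ∈ range i, y k)
    (hresx : ∀ i, i ≤ n → c * ∏ k ∈ range i, x k = c - ∑ k ∈ range i, x k)
    (hef : ∑ k ∈ range n, x k - ∑ k ∈ range n, y k = e - f)
    (hfin : (∏ k ∈ range n, y k) * e ^ j ≤ (∏ k ∈ range n, x k) * f ^ j) :
    ∏ k ∈ range n, y k = ∏ k ∈ range n, x k ∧ e = f := by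
  classical
  have hyp : ∀ i, i ≤ n → 0 < ∏ k ∈ range i, y k := fun i hi =>
    prod_pos fun k hk => hy k (by have := mem_range.1 hk; omega)
  have hxp : ∀ i, i ≤ n → 0 < ∏ k ∈ range i, x k := fun i hi =>
    prod_pos fun k hk => hx k (by have := mem_range.1 hk; omega)
  let P : ℕ → Prop := fun i => ∏ k ∈ range i, x k ≤ ∏ k ∈ range i, y k
  obtain ⟨m, hmn, hPm, hmax⟩ : ∃ m, m ≤ n ∧ P m ∧ ∀ i, m < i → i ≤ n → ¬ P i := by
    refine ⟨Nat.findGreatest P n, Nat.findGreatest_le n, ?_, fun i h1 h2 =>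
      Nat.findGreatest_is_greatest h1 h2⟩
    exact Nat.findGreatest_spec (P := P) (m := 0) (Nat.zero_le n) (by simp [P])
  have hPm' : ∏ k ∈ range m, x k ≤ ∏ k ∈ range m, y k := hPm
  have hrm : c - ∑ k ∈ range m, x k ≤ c - ∑ k ∈ range m, y k := by
    rw [← hresx m hmn]
    exact (mul_le_mul_of_nonneg_left hPm' hc.le).trans (hres m hmn)
  rcases hmn.eq_or_lt with rfl | hlt
  · have hfe : f ≤ e := by linarith
    have hpow : f ^ j ≤ e ^ j := pow_le_pow_left₀ hf.le hfe j
    have h1 : ∏ k ∈ range m, y k ≤ ∏ k ∈ range m, x k := by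
      by_contra h
      push Not at h
      have : (∏ k ∈ range m, x k) * f ^ j < (∏ k ∈ range m, y k) * e ^ j :=
        mul_lt_mul h hpow (pow_pos hf j) (hyp m le_rfl).le
      linarith
    have h2 := le_antisymm h1 hPm'
    refine ⟨h2, le_antisymm ?_ hfe⟩
    rw [h2] at hfin
    have h3 := le_of_mul_le_mul_left hfin (hxp m le_rfl)
    exact (pow_le_pow_iff_left₀ he.le hf.le (by omega)).1 h3
  · exfalso
    obtain ⟨N, rfl⟩ : ∃ N, n = m + (N + 1) := ⟨n - m - 1, by omega⟩
    have key := sum_lt_sum_of_prod_lt_prod (y := fun i => y (m + i)) (x := fun i => x (m + i))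
      (N := N) (j := j) (e := e) (f := f) (fun i hi => hy _ (by omega))
      (fun i hi => hx _ (by omega)) he hf hj (fun i hi => hanti (m + i) (by omega))
      (hlast _ (by omega)) ?_ ?_
    · rw [sum_range_add x m (N + 1), sum_range_add y m (N + 1)] at hef
      linarith
    · intro i hi
      have h := hmax (m + (i + 1)) (by omega) (by omega)
      simp only [P, not_le] at h
      rw [prod_range_add y m (i + 1), prod_range_add x m (i + 1)] at h
      by_contra h'
      push Not at h'
      have := mul_le_mul hPm' h' (prod_nonneg fun k hk => (hx _ ?_).le) (hyp m (by omega)).le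
      · linarith
      · have := mem_range.1 hk
        omega
    · rw [prod_range_add y m (N + 1), prod_range_add x m (N + 1)] at hfin
      have hpos : 0 < (∏ k ∈ range (N + 1), x (m + k)) * f ^ j := by
        refine mul_pos (prod_pos fun k hk => hx _ ?_) (pow_pos hf j)
        have := mem_range.1 hk
        omega
      have hpm := hyp m (by omega)
      refine le_of_mul_le_mul_left ?_ hpm
      calc _ ≤ (∏ k ∈ range m, x k) * ((∏ k ∈ range (N + 1), x (m + k)) * f ^ j) := by
            linarith
        _ ≤ _ := by gcongr

open Finset in
-- Once the total products agree, the last entries of y and x can play the roles of e and f with j =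
-- 1, and the comparison repeats with one entry fewer.
theorem eq_of_prod_mul_pow_le {y x : ℕ → ℝ} {c : ℝ} {n j : ℕ} {e f : ℝ} (hc : 0 < c)
    (hy : ∀ i, i < n → 0 < y i) (hx : ∀ i, i < n → 0 < x i) (he : 0 < e) (hf : 0 < f)
    (hj : 1 ≤ j) (hanti : ∀ i, i + 1 < n → y (i + 1) ≤ y i) (hlast : ∀ i, i + 1 = n → e / j ≤ y i)
    (hres : ∀ i, i ≤ n → c * ∏ k ∈ range i, y k ≤ c - ∑ k ∈ range i, y k)
    (hresx : ∀ i, i ≤ n → c * ∏ k ∈ range i, x k = c - ∑ k ∈ range i, x k)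
    (hef : ∑ k ∈ range n, x k - ∑ k ∈ range n, y k = e - f)
    (hfin : (∏ k ∈ range n, y k) * e ^ j ≤ (∏ k ∈ range n, x k) * f ^ j) :
    e = f ∧ ∀ i, i < n → y i = x i := by
  induction n generalizing j e f with
  | zero =>
    refine ⟨?_, by simp⟩
    simpa [sub_eq_zero, eq_comm] using hef
  | succ n ih =>
    obtain ⟨hp, hef'⟩ := prod_eq_and_eq_of_prod_mul_pow_le hc hy hx he hf hj hanti hlast hres
      hresx hef hfin
    refine ⟨hef', ?_⟩
    rw [hef', sub_self] at hef
    obtain ⟨h1, h2⟩ := ih (j := 1) (e := y n) (f := x n) (fun i hi => hy i (by omega))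
      (fun i hi => hx i (by omega)) (hy n (by omega)) (hx n (by omega)) le_rfl
      (fun i hi => hanti i (by omega))
      (fun i hi => by subst hi; simpa using hanti i (by omega))
      (fun i hi => hres i (by omega)) (fun i hi => hresx i (by omega))
      (by rw [sum_range_succ, sum_range_succ] at hef; linarith)
      (by rw [prod_range_succ, prod_range_succ] at hp; simpa using hp.le)
    intro i hi
    rcases Nat.lt_succ_iff_lt_or_eq.1 hi with h | rfl
    · exact h2 i h
    · exact h1

/-- On `τ / (j + 2) ≤ a` and `j a ≤ τ - a`, the product `a (τ - a) ^ j` is smallest at the left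
end. -/
theorem pow_le_mul_pow_sub {a τ : ℝ} {j : ℕ} (hτ : 0 < τ) (h1 : τ / (j + 2) ≤ a)
    (h2 : j * a ≤ τ - a) :
    (τ / (j + 2)) ^ (j + 1) ≤ a * ((τ - a) / (j + 1)) ^ j := by
  have hj : (0 : ℝ) ≤ j := Nat.cast_nonneg j
  set b := τ / (j + 2) with hb
  have hbpos : 0 < b := by positivity
  have hτb : τ = (j + 2) * b := by rw [hb]; field_simp
  have ha : 0 < a := hbpos.trans_le h1
  set z := (τ - a) / (j + 1) with hz
  have hzj : (j + 1) * z = τ - a := by rw [hz]; field_simp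
  have hz0 : 0 ≤ z := by
    rw [hz]
    exact div_nonneg (by nlinarith [mul_nonneg hj ha.le]) (by linarith)
  -- Bernoulli for `z / b = 1 - (a - b) / ((j + 1) b)`
  have hber := one_add_mul_le_pow (a := z / b - 1)
    (by have := div_nonneg hz0 hbpos.le; linarith) j
  have hbz : a * b ^ j * (1 + j * (z / b - 1)) ≤ a * b ^ j * (z / b) ^ j := by
    have : 1 + (z / b - 1) = z / b := by ring
    rw [this] at hber
    gcongr
  have e1 : a * b ^ j * (z / b) ^ j = a * z ^ j := by
    rw [mul_assoc, ← mul_pow, mul_div_cancel₀ _ hbpos.ne']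
  rw [e1] at hbz
  refine le_trans ?_ hbz
  rw [pow_succ]
  have e2 : a * b ^ j * (1 + j * (z / b - 1)) = b ^ j * (a * (1 + j * (z / b - 1))) := by ring
  rw [e2]
  gcongr
  have e3 : z = b - (a - b) / (j + 1) := by
    rw [hz, hτb]; field_simp; ring
  have e4 : 1 + j * (z / b - 1) = 1 - j * (a - b) / ((j + 1) * b) := by
    rw [e3]; field_simp; ring
  rw [e4]
  have h3 : j * a ≤ (j + 1) * b := by nlinarith
  have e5 : a * (1 - j * (a - b) / ((j + 1) * b)) - b = (a - b) * (((j + 1) * b - j * a) / ((j + 1) * b)) := by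
    field_simp; ring
  have : 0 ≤ (a - b) * (((j + 1) * b - j * a) / ((j + 1) * b)) :=
    mul_nonneg (by linarith) (div_nonneg (by linarith) (by positivity))
  linarith

open Finset in
-- Smoothing from the right: the tail is replaced by copies of its mean, and the block is lengthened
-- until the entry before it is large enough for the comparison with x, or until it covers
-- everything. Only j of the j + 1 block entries enter the product, since y_d is not a factor.
theorem exists_block_le_prod {y x : ℕ → ℝ} {c : ℝ} {d : ℕ} (hc : 0 < c) (hd : 1 ≤ d)
    (hy : ∀ i, i ≤ d → 0 < y i) (hx : ∀ i, i < d → 0 < x i)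
    (hanti : ∀ i j, i ≤ j → j ≤ d → y j ≤ y i) (hsum : ∑ k ∈ range (d + 1), y k = c)
    (hres : ∀ i, i ≤ d → c * ∏ k ∈ range i, y k ≤ c - ∑ k ∈ range i, y k)
    (hresx : ∀ i, i ≤ d → c * ∏ k ∈ range i, x k = c - ∑ k ∈ range i, x k) :
    ∃ m j : ℕ, m + j = d ∧ 1 ≤ j ∧
      (∏ k ∈ range m, x k) * ((c - ∑ k ∈ range m, x k) / (j + 1)) ^ j ≤ ∏ k ∈ range d, y k ∧
      (∏ k ∈ range d, y k ≤ (∏ k ∈ range m, x k) * ((c - ∑ k ∈ range m, x k) / (j + 1)) ^ j →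
        ∀ i, i < m → y i = x i) := by
  have hrpos : ∀ i, i ≤ d → 0 < c - ∑ k ∈ range i, y k := fun i hi =>
    (mul_pos hc (prod_pos fun k hk => hy k (by have := mem_range.1 hk; omega))).trans_le (hres i hi)
  have hRpos : ∀ i, i ≤ d → 0 < c - ∑ k ∈ range i, x k := fun i hi => by
    rw [← hresx i hi]
    exact mul_pos hc (prod_pos fun k hk => hx k (by have := mem_range.1 hk; omega))
  have tail : ∀ m n : ℕ, m + n = d + 1 → c - ∑ k ∈ range m, y k ≤ n * y m := by
    intro m n hmn
    rw [← hsum, ← hmn, sum_range_add y m n, add_sub_cancel_left]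
    calc ∑ k ∈ range n, y (m + k) ≤ ∑ k ∈ range n, y m :=
          sum_le_sum fun k hk => hanti _ _ (by omega) (by have := mem_range.1 hk; omega)
      _ = n * y m := by simp
  -- The invariant says that flattening all entries from index m on does not increase the product.
  -- It starts at m = d - 1, j = 1, where y_{d-1} is at least the mean of y_{d-1} and y_d.
  suffices H : ∀ m j : ℕ, m + j = d → 1 ≤ j →
      (∏ k ∈ range m, y k) * ((c - ∑ k ∈ range m, y k) / (j + 1)) ^ j ≤ ∏ k ∈ range d, y k →
      ∃ m j : ℕ, m + j = d ∧ 1 ≤ j ∧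
      (∏ k ∈ range m, x k) * ((c - ∑ k ∈ range m, x k) / (j + 1)) ^ j ≤ ∏ k ∈ range d, y k ∧
      (∏ k ∈ range d, y k ≤ (∏ k ∈ range m, x k) * ((c - ∑ k ∈ range m, x k) / (j + 1)) ^ j →
        ∀ i, i < m → y i = x i) by
    obtain ⟨e, rfl⟩ : ∃ e, d = e + 1 := ⟨d - 1, by omega⟩
    refine H e 1 rfl le_rfl ?_
    rw [prod_range_succ, pow_one]
    refine mul_le_mul_of_nonneg_left ?_ (prod_nonneg fun k hk => (hy k ?_).le)
    · have := tail e 2 rfl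
      rw [div_le_iff₀ (by positivity)]
      push_cast at this ⊢
      linarith
    · have := mem_range.1 hk
      omega
  intro m
  induction m with
  | zero =>
    intro j hj hj1 h
    exact ⟨0, j, hj, hj1, by simpa using h, by simp⟩
  | succ m ih =>
    intro j hj hj1 h
    have hjpos : (0 : ℝ) < j := by exact_mod_cast hj1
    -- If y_m dominates the remainder divided by j, then `eq_of_prod_mul_pow_le` compares y with x
    -- and the block stops here.
    by_cases hcase : (c - ∑ k ∈ range (m + 1), y k) / j ≤ y m
    · have main : (∏ k ∈ range (m + 1), y k) * (c - ∑ k ∈ range (m + 1), y k) ^ j ≤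
          (∏ k ∈ range (m + 1), x k) * (c - ∑ k ∈ range (m + 1), x k) ^ j →
          (c - ∑ k ∈ range (m + 1), y k) = (c - ∑ k ∈ range (m + 1), x k) ∧
          ∀ i, i < m + 1 → y i = x i := fun h =>
        eq_of_prod_mul_pow_le hc (fun i hi => hy i (by omega)) (fun i hi => hx i (by omega))
          (hrpos _ (by omega)) (hRpos _ (by omega)) hj1
          (fun i hi => hanti _ _ (by omega) (by omega))
          (fun i hi => by obtain rfl : i = m := by omega
                          exact hcase)
          (fun i hi => hres i (by omega)) (fun i hi => hresx i (by omega)) (by ring) h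
      have hle : (∏ k ∈ range (m + 1), x k) * (c - ∑ k ∈ range (m + 1), x k) ^ j ≤
          (∏ k ∈ range (m + 1), y k) * (c - ∑ k ∈ range (m + 1), y k) ^ j := by
        by_contra hlt
        push Not at hlt
        obtain ⟨h1, h2⟩ := main hlt.le
        rw [h1, prod_congr rfl fun k hk => h2 k (mem_range.1 hk)] at hlt
        exact lt_irrefl _ hlt
      refine ⟨m + 1, j, hj, hj1, ?_, fun h' => (main ?_).2⟩
      · refine le_trans ?_ h
        rw [div_pow, div_pow, ← mul_div_assoc, ← mul_div_assoc]
        gcongr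
      · have := h.trans h'
        rw [div_pow, div_pow, ← mul_div_assoc, ← mul_div_assoc] at this
        exact (div_le_div_iff_of_pos_right (by positivity)).1 this
    -- Otherwise y_m lies between the mean of its own tail and the remainder divided by j. In this
    -- range absorbing y_m into the block does not increase the product.
    · push Not at hcase
      refine ih (j + 1) (by omega) (by omega) (le_trans ?_ h)
      rw [prod_range_succ, mul_assoc]
      refine mul_le_mul_of_nonneg_left ?_ (prod_nonneg fun k hk => (hy k ?_).le)
      · have hτ := hrpos m (by omega)
        have e1 : c - ∑ k ∈ range (m + 1), y k = (c - ∑ k ∈ range m, y k) - y m := by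
          rw [sum_range_succ]; ring
        have ht := tail m (j + 2) (by omega)
        rw [e1] at hcase ⊢
        have := pow_le_mul_pow_sub (a := y m) (j := j) hτ
          (by rw [div_le_iff₀ (by positivity)]; push_cast at ht; linarith)
          (by rw [lt_div_iff₀ hjpos] at hcase; linarith)
        push_cast
        rwa [add_assoc, one_add_one_eq_two]
      · have := mem_range.1 hk
        omega

/-! ### The Sylvester sequence -/

theorem sylvester_succ_succ (g k : ℕ) :
    sylvester g (k + 2) = sylvester g (k + 1) * (sylvester g (k + 1) - 1) + 1 := rfl

theorem truncSylvester_one (g : ℕ) : truncSylvester g 1 = g := by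
  simp [truncSylvester, sylvester]

theorem truncSylvester_succ (g k : ℕ) :
    truncSylvester g (k + 2) = truncSylvester g (k + 1) * (truncSylvester g (k + 1) + 1) := by
  simp only [truncSylvester, sylvester_succ_succ]; ring

theorem sylvester_eq_truncSylvester_add_one (g k : ℕ) :
    sylvester g k = truncSylvester g k + 1 := by
  simp [truncSylvester]

open Finset in
theorem truncSylvester_eq_prod (g k : ℕ) :
    truncSylvester g (k + 1) = g * ∏ i ∈ range k, sylvester g (i + 1) := by
  induction k with
  | zero => simp [truncSylvester_one]
  | succ k ih =>
    rw [prod_range_succ, ← mul_assoc, ← ih, truncSylvester_succ,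
      sylvester_eq_truncSylvester_add_one]

theorem truncSylvester_pos {g : ℕ} (hg : 1 ≤ g) (k : ℕ) : 1 ≤ truncSylvester g (k + 1) := by
  induction k with
  | zero => rw [truncSylvester_one]; exact_mod_cast hg
  | succ k ih => rw [truncSylvester_succ]; nlinarith

theorem two_le_truncSylvester {g : ℕ} (hg : 1 ≤ g) (k : ℕ) : 2 ≤ truncSylvester g (k + 2) := by
  rw [truncSylvester_succ]; nlinarith [truncSylvester_pos hg k]

theorem sylvester_pos {g : ℕ} (hg : 1 ≤ g) (k : ℕ) : 2 ≤ sylvester g (k + 1) := by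
  rw [sylvester_eq_truncSylvester_add_one]; linarith [truncSylvester_pos hg k]

open Finset in
-- The step is 1/t - 1/(t+1) = 1/(t(t+1)). Together with `prod_one_div_sylvester` it shows that the
-- reciprocals of the Sylvester terms meet the remainder bound with equality.
theorem sum_one_div_sylvester {g : ℕ} (hg : 1 ≤ g) (k : ℕ) :
    (1 : ℝ) / g - ∑ i ∈ range k, (1 : ℝ) / sylvester g (i + 1) = 1 / truncSylvester g (k + 1) := by
  induction k with
  | zero => simp [truncSylvester_one]
  | succ k ih =>
    have h := truncSylvester_pos hg k
    have h' : (1 : ℝ) ≤ truncSylvester g (k + 1) := by exact_mod_cast h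
    rw [sum_range_succ, ← sub_sub, ih, truncSylvester_succ, sylvester_eq_truncSylvester_add_one]
    push_cast
    field_simp
    ring

open Finset in
theorem prod_one_div_sylvester (g k : ℕ) :
    (1 : ℝ) / g * ∏ i ∈ range k, (1 : ℝ) / sylvester g (i + 1) = 1 / truncSylvester g (k + 1) := by
  rw [truncSylvester_eq_prod]
  push_cast
  simp only [one_div, prod_inv_distrib, mul_inv]

/-! ### Comparison of the candidate maxima -/

/-- This is the case t = 1 of `pow_mul_pow_lt`. It fails for j = 1, where 9 > 8, and this failure is
the exceptional case (d, g) = (2, 1). -/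
theorem succ_pow_lt {j : ℕ} (hj : 2 ≤ j) : (j + 2) ^ (j + 1) < (j + 1) ^ j * 2 ^ (j + 1) := by
  induction j, hj using Nat.le_induction with
  | base => norm_num
  | succ j hj ih =>
    have h1 : ((j + 3) * (j + 1)) ^ (j + 1) ≤ ((j + 2) * (j + 2)) ^ (j + 1) :=
      Nat.pow_le_pow_left (by nlinarith) _
    have h2 : j + 3 ≤ 2 * (j + 1) := by omega
    have h3 : (j + 3) ^ (j + 2) * (j + 1) ^ (j + 1) ≤
        (j + 2) ^ (j + 1) * (2 * (j + 1) * (j + 2) ^ (j + 1)) := by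
      calc (j + 3) ^ (j + 2) * (j + 1) ^ (j + 1) = ((j + 3) * (j + 1)) ^ (j + 1) * (j + 3) := by
            rw [mul_pow]; ring
        _ ≤ ((j + 2) * (j + 2)) ^ (j + 1) * (2 * (j + 1)) := Nat.mul_le_mul h1 h2
        _ = _ := by rw [mul_pow]; ring
    have h4 : (j + 2) ^ (j + 1) * (2 * (j + 1) * (j + 2) ^ (j + 1)) <
        (j + 1) ^ j * 2 ^ (j + 1) * (2 * (j + 1) * (j + 2) ^ (j + 1)) :=
      Nat.mul_lt_mul_of_pos_right ih (by positivity)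
    refine lt_of_mul_lt_mul_right (a := (j + 1) ^ (j + 1)) ?_ (Nat.zero_le _)
    calc _ = (j + 3) ^ (j + 2) * (j + 1) ^ (j + 1) := by ring
      _ ≤ _ := h3
      _ < _ := h4
      _ = _ := by ring

/-- With t = t_{g,m+1}, the left side is the candidate with m Sylvester terms and j + 2 equal ones.
The right side has one more Sylvester term and j + 1 equal ones, as t_{g,m+2} = t (t + 1). -/
theorem pow_mul_pow_lt {j : ℕ} (hj : 2 ≤ j) {t : ℤ} (ht : 1 ≤ t) :
    ((j : ℤ) + 2) ^ (j + 1) * t ^ (j + 2) < ((j : ℤ) + 1) ^ j * (t * (t + 1)) ^ (j + 1) := by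
  have h1 : ((j : ℤ) + 2) ^ (j + 1) < ((j : ℤ) + 1) ^ j * 2 ^ (j + 1) := by
    exact_mod_cast succ_pow_lt hj
  have h2 : t * 2 ^ (j + 1) ≤ (t + 1) ^ (j + 1) := by
    obtain ⟨i, rfl⟩ : ∃ i, j = i + 1 := ⟨j - 1, by omega⟩
    have h3 : (2 : ℤ) ^ i ≤ (t + 1) ^ i := pow_le_pow_left₀ (by norm_num) (by linarith) _
    calc t * 2 ^ (i + 1 + 1) = 2 ^ i * (4 * t) := by ring
      _ ≤ (t + 1) ^ i * (t + 1) ^ 2 := by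
          gcongr
          nlinarith [sq_nonneg (t - 1)]
      _ = _ := by ring
  have htp : 0 < t ^ (j + 1) := by positivity
  calc ((j : ℤ) + 2) ^ (j + 1) * t ^ (j + 2) = ((j : ℤ) + 2) ^ (j + 1) * (t * t ^ (j + 1)) := by
        ring
    _ < ((j : ℤ) + 1) ^ j * 2 ^ (j + 1) * (t * t ^ (j + 1)) := by gcongr
    _ = ((j : ℤ) + 1) ^ j * (t ^ (j + 1) * (t * 2 ^ (j + 1))) := by ring
    _ ≤ ((j : ℤ) + 1) ^ j * (t ^ (j + 1) * (t + 1) ^ (j + 1)) := by gcongr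
    _ = _ := by rw [mul_pow]

/-- Equal terms are traded one by one for Sylvester terms until j = 2; in dimension d = e + 2 that
candidate is 9 t_{g,d-1}^3. -/
theorem candidate_lt {g : ℕ} (hg : 1 ≤ g) {e m j : ℕ} (hmj : m + j = e + 2) (hj : 3 ≤ j) :
    ((j : ℤ) + 1) ^ j * truncSylvester g (m + 1) ^ (j + 1) < 9 * truncSylvester g (e + 1) ^ 3 := by
  obtain ⟨i, rfl⟩ : ∃ i, j = i + 3 := ⟨j - 3, by omega⟩
  obtain rfl : e = m + i + 1 := by omega
  clear hmj hj
  induction i generalizing m with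
  | zero =>
    have := pow_mul_pow_lt (j := 2) le_rfl (truncSylvester_pos hg m)
    simp only [zero_add, add_zero]
    rw [truncSylvester_succ]
    push_cast at this ⊢
    linarith
  | succ i ih =>
    have h := pow_mul_pow_lt (j := i + 3) (by omega) (truncSylvester_pos hg m)
    rw [← truncSylvester_succ] at h
    have h2 := ih (m := m + 1)
    have e1 : m + 1 + i + 1 = m + (i + 1) + 1 := by ring
    rw [e1] at h2
    refine lt_trans ?_ h2
    have e2 : ((i + 3 : ℕ) : ℤ) + 2 = ((i + 1 + 3 : ℕ) : ℤ) + 1 := by push_cast; ring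
    rw [e2] at h
    exact h

/-- This compares the candidates j = 2 and j = 1, with t = t_{g,d-1}. The factor t - 2 vanishes at t
= 2, the source of the sporadic tetrahedron, and is negative at t = 1. -/
theorem candidate_two_le {t : ℤ} (ht : 2 ≤ t) : 9 * t ^ 3 ≤ 2 * (t * (t + 1)) ^ 2 := by
  have : 2 * (t * (t + 1)) ^ 2 - 9 * t ^ 3 = t ^ 2 * ((2 * t - 1) * (t - 2)) := by ring
  nlinarith [mul_nonneg (sq_nonneg t) (mul_nonneg (by linarith : (0 : ℤ) ≤ 2 * t - 1)
    (by linarith : (0 : ℤ) ≤ t - 2))]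

theorem candidate_two_lt {t : ℤ} (ht : 3 ≤ t) : 9 * t ^ 3 < 2 * (t * (t + 1)) ^ 2 := by
  have : 2 * (t * (t + 1)) ^ 2 - 9 * t ^ 3 = t ^ 2 * ((2 * t - 1) * (t - 2)) := by ring
  have h2 : 0 < t ^ 2 * ((2 * t - 1) * (t - 2)) :=
    mul_pos (by positivity) (mul_pos (by linarith) (by linarith))
  linarith

/-! ### Unit fraction partitions of 1/g with the largest product. -/

open Finset in
-- Common denominators: a positive remainder is therefore at least 1/(g ∏ A_k), which is the only
-- place where integrality of the A_k enters the bound.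
theorem exists_sub_sum_inv_eq (A : ℕ → ℤ) {g : ℕ} (hg : 1 ≤ g) (n : ℕ) (hA : ∀ i, i < n → 0 < A i) :
    ∃ N : ℤ, (1 : ℝ) / g - ∑ k ∈ range n, 1 / (A k : ℝ) =
      N * (1 / g * ∏ k ∈ range n, 1 / (A k : ℝ)) := by
  have hg' : (0 : ℝ) < g := by exact_mod_cast hg
  induction n with
  | zero => exact ⟨1, by simp⟩
  | succ n ih =>
    obtain ⟨N, hN⟩ := ih fun i hi => hA i (by omega)
    have hAn : (0 : ℝ) < A n := by exact_mod_cast hA n (by omega)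
    refine ⟨N * A n - g * ∏ k ∈ range n, A k, ?_⟩
    rw [sum_range_succ, ← sub_sub, hN, prod_range_succ]
    push_cast
    have hp : (∏ k ∈ range n, (A k : ℝ)) * ∏ k ∈ range n, 1 / (A k : ℝ) = 1 := by
      rw [← prod_mul_distrib]
      refine prod_eq_one fun k hk => mul_one_div_cancel ?_
      exact_mod_cast (hA k (by have := mem_range.1 hk; omega)).ne'
    field_simp
    linear_combination (g : ℝ) * hp

open Finset in
theorem exists_prod_le_candidate {A : ℕ → ℤ} {d g : ℕ} (hg : 1 ≤ g) (hd : 1 ≤ d)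
    (hA : ∀ i, i ≤ d → 0 < A i) (hmono : ∀ i j, i ≤ j → j ≤ d → A i ≤ A j)
    (hsum : ∑ k ∈ range (d + 1), 1 / (A k : ℝ) = 1 / g) :
    ∃ m j : ℕ, m + j = d ∧ 1 ≤ j ∧
      g * ∏ k ∈ range d, A k ≤ ((j : ℤ) + 1) ^ j * truncSylvester g (m + 1) ^ (j + 1) ∧
      (((j : ℤ) + 1) ^ j * truncSylvester g (m + 1) ^ (j + 1) ≤ g * ∏ k ∈ range d, A k →
        ∀ i, i < m → A i = sylvester g (i + 1)) := by
  have hg' : (0 : ℝ) < g := by exact_mod_cast hg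
  have hA' : ∀ i, i ≤ d → (0 : ℝ) < A i := fun i hi => by exact_mod_cast hA i hi
  have hS : ∀ i, (0 : ℝ) < sylvester g (i + 1) := fun i => by
    exact_mod_cast (by norm_num : (0 : ℤ) < 2).trans_le (sylvester_pos hg i)
  have hres : ∀ i, i ≤ d → (1 : ℝ) / g * ∏ k ∈ range i, 1 / (A k : ℝ) ≤
      1 / g - ∑ k ∈ range i, 1 / (A k : ℝ) := by
    intro i hi
    obtain ⟨N, hN⟩ := exists_sub_sum_inv_eq A hg i fun k hk => hA k (by omega)
    have hpos : 0 < (1 : ℝ) / g * ∏ k ∈ range i, 1 / (A k : ℝ) :=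
      mul_pos (by positivity) (prod_pos fun k hk => one_div_pos.2
        (hA' k (by have := mem_range.1 hk; omega)))
    have hr : 0 < (1 : ℝ) / g - ∑ k ∈ range i, 1 / (A k : ℝ) := by
      obtain ⟨n, hn⟩ : ∃ n, d + 1 = i + (n + 1) := ⟨d - i, by omega⟩
      rw [← hsum, hn, sum_range_add _ i (n + 1), add_sub_cancel_left]
      exact sum_pos (fun k hk => one_div_pos.2 (hA' _ (by have := mem_range.1 hk; omega)))
        (by simp)
    rw [hN] at hr ⊢
    have hN0 : 1 ≤ N := by
      have : (0 : ℝ) < N := pos_of_mul_pos_left hr hpos.le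
      have : 0 < N := by exact_mod_cast this
      omega
    have : (1 : ℝ) ≤ N := by exact_mod_cast hN0
    nlinarith
  obtain ⟨m, j, hmj, hj, hle, heq⟩ := exists_block_le_prod (y := fun i => 1 / (A i : ℝ))
    (x := fun i => 1 / (sylvester g (i + 1) : ℝ)) (c := 1 / g) (d := d) (by positivity) hd
    (fun i hi => one_div_pos.2 (hA' i hi)) (fun i _ => one_div_pos.2 (hS i))
    (fun i j hij hj => one_div_le_one_div_of_le (hA' i (hij.trans hj))
      (by exact_mod_cast hmono i j hij hj)) hsum hres
    (fun i _ => by rw [prod_one_div_sylvester, sum_one_div_sylvester hg])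
  have hprod : (0 : ℝ) < g * ∏ k ∈ range d, (A k : ℝ) :=
    mul_pos hg' (prod_pos fun k hk => hA' k (mem_range.1 hk).le)
  have ht : (1 : ℝ) ≤ truncSylvester g (m + 1) := by exact_mod_cast truncSylvester_pos hg m
  have e1 : ∏ k ∈ range d, 1 / (A k : ℝ) = g / (g * ∏ k ∈ range d, (A k : ℝ)) := by
    simp only [one_div, prod_inv_distrib]
    field_simp
  have e2 : (∏ k ∈ range m, 1 / (sylvester g (k + 1) : ℝ)) *
      ((1 / g - ∑ k ∈ range m, 1 / (sylvester g (k + 1) : ℝ)) / (j + 1)) ^ j =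
      g / (((j : ℝ) + 1) ^ j * truncSylvester g (m + 1) ^ (j + 1)) := by
    have h1 := prod_one_div_sylvester g m
    have h2 : ∏ k ∈ range m, 1 / (sylvester g (k + 1) : ℝ) = g / truncSylvester g (m + 1) := by
      field_simp at h1 ⊢
      linarith
    rw [sum_one_div_sylvester hg, h2, div_pow, div_pow, one_pow]
    field_simp
    ring
  rw [e1, e2] at hle heq
  have hc : (0 : ℝ) < ((j : ℝ) + 1) ^ j * truncSylvester g (m + 1) ^ (j + 1) := by positivity
  refine ⟨m, j, hmj, hj, ?_, fun h i hi => ?_⟩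
  · have := (div_le_div_iff_of_pos_left hg' hc hprod).1 hle
    exact_mod_cast this
  · have h' : ((j : ℝ) + 1) ^ j * truncSylvester g (m + 1) ^ (j + 1) ≤
        g * ∏ k ∈ range d, (A k : ℝ) := by exact_mod_cast h
    have := heq ((div_le_div_iff_of_pos_left hg' hprod hc).2 h') i hi
    rw [div_eq_div_iff (hA' i (by omega)).ne' (hS i).ne'] at this
    simp only [one_mul] at this
    exact_mod_cast this.symm

/-- This resolves the tie at t_{g,d-1} = 2. The first solution is a block of three equal terms; the
second is the Sylvester term 3 followed by a block of two, so it belongs to the general extremal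
partition. -/
theorem eq_of_mul_eq_thirty_six {a b c : ℤ} (ha : 0 < a) (hab : a ≤ b) (hbc : b ≤ c)
    (h : a * b = 36) (hsum : (1 : ℝ) / a + 1 / b + 1 / c = 1 / 2) :
    (a = 6 ∧ b = 6 ∧ c = 6) ∨ (a = 3 ∧ b = 12 ∧ c = 12) := by
  have ha' : (0 : ℝ) < a := by exact_mod_cast ha
  have hb' : (0 : ℝ) < b := by exact_mod_cast ha.trans_le hab
  have hc' : (0 : ℝ) < c := by exact_mod_cast (ha.trans_le hab).trans_le hbc
  have h2 : 2 * (b * c + a * c + a * b) = a * b * c := by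
    field_simp at hsum
    have : (2 : ℝ) * (b * c + a * c + a * b) = a * b * c := by linarith
    exact_mod_cast this
  rw [h] at h2
  have ha6 : a ≤ 6 := by nlinarith
  interval_cases a
  · obtain rfl : b = 36 := by omega
    omega
  · obtain rfl : b = 18 := by omega
    omega
  · obtain rfl : b = 12 := by omega
    omega
  · obtain rfl : b = 9 := by omega
    omega
  · omega
  · obtain rfl : b = 6 := by omega
    omega

theorem eq_three_of_sum_inv_eq_one {a b c : ℤ} (ha : 0 < a) (hab : a ≤ b) (hbc : b ≤ c)
    (hsum : (1 : ℝ) / a + 1 / b + 1 / c = 1) :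
    a * b ≤ 9 ∧ (a * b = 9 → a = 3 ∧ b = 3 ∧ c = 3) := by
  have ha' : (0 : ℝ) < a := by exact_mod_cast ha
  have hb' : (0 : ℝ) < b := by exact_mod_cast ha.trans_le hab
  have hc' : (0 : ℝ) < c := by exact_mod_cast (ha.trans_le hab).trans_le hbc
  have h2 : b * c + a * c + a * b = a * b * c := by
    field_simp at hsum
    have : (b : ℝ) * c + a * c + a * b = a * b * c := by linarith
    exact_mod_cast this
  have ha3 : a ≤ 3 := by
    by_contra h
    push Not at h
    nlinarith [mul_nonneg (sub_nonneg.2 hab) (by linarith : 0 ≤ c), mul_pos (ha.trans_le hab) (by linarith : 0 < c)]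
  have hb4 : a = 1 ∨ (a = 2 ∧ b ≤ 4) ∨ (a = 3 ∧ b ≤ 3) := by
    interval_cases a
    · simp
    · right; left; refine ⟨rfl, ?_⟩; by_contra h; push Not at h; nlinarith
    · right; right; refine ⟨rfl, ?_⟩; by_contra h; push Not at h; nlinarith
  rcases hb4 with rfl | ⟨rfl, h⟩ | ⟨rfl, h⟩
  · exfalso; nlinarith
  · exact ⟨by linarith, by omega⟩
  · obtain rfl : b = 3 := by omega
    exact ⟨by norm_num, by omega⟩

open Finset in
-- The dimension is e + 2. The block bound is at most the j = 1 value: equality holds for j = 1,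
-- needs t_{g,e+1} = 2 for j = 2, and is impossible for j ≥ 3.
theorem mul_prod_le_of_sum_inv_eq {A : ℕ → ℤ} {e g : ℕ} (hg : 1 ≤ g) (hne : ¬ (e = 0 ∧ g = 1))
    (hA : ∀ i, i ≤ e + 2 → 0 < A i) (hmono : ∀ i j, i ≤ j → j ≤ e + 2 → A i ≤ A j)
    (hsum : ∑ k ∈ range (e + 3), 1 / (A k : ℝ) = 1 / g) :
    g * ∏ k ∈ range (e + 2), A k ≤ 2 * truncSylvester g (e + 2) ^ 2 ∧
    (g * ∏ k ∈ range (e + 2), A k = 2 * truncSylvester g (e + 2) ^ 2 →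
      ((∀ i, i < e + 1 → A i = sylvester g (i + 1)) ∧ A (e + 1) = 2 * truncSylvester g (e + 2) ∧
        A (e + 2) = 2 * truncSylvester g (e + 2)) ∨
      (e = 1 ∧ g = 1 ∧ A 0 = 2 ∧ A 1 = 6 ∧ A 2 = 6 ∧ A 3 = 6) ∨
      (e = 0 ∧ g = 2 ∧ A 0 = 6 ∧ A 1 = 6 ∧ A 2 = 6)) := by
  obtain ⟨m, j, hmj, hj, hle, heq⟩ := exists_prod_le_candidate hg (by omega) hA hmono hsum
  have hte : 2 ≤ truncSylvester g (e + 1) := by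
    rcases e with _ | e
    · have : 2 ≤ g := by
        simp only [true_and] at hne
        omega
      rw [zero_add, truncSylvester_one]
      exact_mod_cast this
    · exact two_le_truncSylvester hg e
  have h2le := candidate_two_le hte
  rw [← truncSylvester_succ] at h2le
  have finish : (∀ i, i < e + 1 → A i = sylvester g (i + 1)) →
      g * ∏ k ∈ range (e + 2), A k = 2 * truncSylvester g (e + 2) ^ 2 →
      (∀ i, i < e + 1 → A i = sylvester g (i + 1)) ∧ A (e + 1) = 2 * truncSylvester g (e + 2) ∧
        A (e + 2) = 2 * truncSylvester g (e + 2) := by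
    intro h hp
    have ht : 1 ≤ truncSylvester g (e + 2) := truncSylvester_pos hg (e + 1)
    have h1 : A (e + 1) = 2 * truncSylvester g (e + 2) := by
      rw [prod_range_succ, prod_congr rfl fun k hk => h k (mem_range.1 hk), ← mul_assoc,
        ← truncSylvester_eq_prod] at hp
      refine mul_left_cancel₀ (a := truncSylvester g (e + 2)) (by omega) ?_
      rw [hp]; ring
    refine ⟨h, h1, ?_⟩
    rw [sum_range_succ, sum_range_succ, sum_congr rfl fun k hk => by
      rw [h k (mem_range.1 hk)]] at hsum
    have h3 := sum_one_div_sylvester hg (e + 1)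
    have ht' : (1 : ℝ) ≤ truncSylvester g (e + 2) := by exact_mod_cast ht
    have hA2 : (0 : ℝ) < A (e + 2) := by exact_mod_cast hA _ le_rfl
    have h4 : (1 : ℝ) / A (e + 2) = 1 / (2 * truncSylvester g (e + 2)) := by
      have h5 : (1 : ℝ) / A (e + 2) = 1 / truncSylvester g (e + 2) - 1 / A (e + 1) := by
        linarith
      rw [h5, h1]
      push_cast
      field_simp
      ring
    rw [div_eq_div_iff hA2.ne' (by positivity)] at h4
    have : (A (e + 2) : ℝ) = 2 * truncSylvester g (e + 2) := by linarith
    exact_mod_cast this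
  obtain rfl | rfl | hj3 : j = 1 ∨ j = 2 ∨ 3 ≤ j := by omega
  · obtain rfl : m = e + 1 := by omega
    norm_num at hle heq
    refine ⟨hle, fun h => Or.inl (finish (fun i hi => heq h.ge i (Nat.lt_succ_iff.1 hi)) h)⟩
  · obtain rfl : m = e := by omega
    norm_num at hle heq
    refine ⟨hle.trans h2le, fun h => ?_⟩
    have hS := heq (h2le.trans h.ge)
    have ht2 : truncSylvester g (m + 1) = 2 := by
      by_contra hne2
      have h3 := candidate_two_lt (t := truncSylvester g (m + 1)) (by omega)
      rw [← truncSylvester_succ] at h3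
      linarith
    have ht6 : truncSylvester g (m + 2) = 6 := by rw [truncSylvester_succ, ht2]; norm_num
    have hp : A m * A (m + 1) = 36 := by
      have h' := h
      rw [prod_range_succ, prod_range_succ, prod_congr rfl fun k hk => hS k (mem_range.1 hk),
        mul_assoc (∏ k ∈ range m, _), ← mul_assoc, ← truncSylvester_eq_prod, ht2, ht6] at h'
      linarith
    have hs : (1 : ℝ) / A m + 1 / A (m + 1) + 1 / A (m + 2) = 1 / 2 := by
      rw [sum_range_succ, sum_range_succ, sum_range_succ, sum_congr rfl fun k hk => by
        rw [hS k (mem_range.1 hk)]] at hsum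
      have h3 := sum_one_div_sylvester hg m
      rw [ht2] at h3
      push_cast at h3
      linarith
    rcases eq_of_mul_eq_thirty_six (hA m (by omega)) (hmono _ _ (by omega) (by omega))
      (hmono _ _ (by omega) (by omega)) hp hs with ⟨h1, h2, h3⟩ | ⟨h1, h2, h3⟩
    · right
      -- The equation t_{g,m+1} = 2 forces g = 2 for m = 0 and g = 1 for m = 1, and is impossible
      -- for m ≥ 2.
      rcases m with _ | _ | m
      · right
        rw [zero_add, truncSylvester_one] at ht2
        exact ⟨rfl, by exact_mod_cast ht2, h1, h2, h3⟩
      · left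
        have hg1 : g = 1 := by
          rw [truncSylvester_succ, zero_add, truncSylvester_one] at ht2
          have : (g : ℤ) < 2 := by nlinarith
          omega
        subst hg1
        refine ⟨rfl, rfl, ?_, h1, h2, h3⟩
        rw [hS 0 (by omega)]
        simp [sylvester]
      · exfalso
        rw [truncSylvester_succ] at ht2
        have := two_le_truncSylvester hg m
        nlinarith
    · left
      refine finish (fun i hi => ?_) h
      rcases Nat.lt_succ_iff_lt_or_eq.1 hi with hi | rfl
      · exact hS i hi
      · rw [h1, sylvester_eq_truncSylvester_add_one, ht2]; norm_num
  · have h3 := candidate_lt hg hmj hj3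
    exact ⟨by linarith, fun h => by linarith⟩

/-! ### The volume of a simplex -/

open MeasureTheory in
-- Fubini in the first coordinate: the slice at t is the corner simplex of size r - t one dimension
-- lower.
theorem volume_corner_simplex (n : ℕ) {r : ℝ} (hr : 0 ≤ r) :
    volume {x : Fin n → ℝ | (∀ i, 0 ≤ x i) ∧ ∑ i, x i ≤ r} =
      ENNReal.ofReal (r ^ n / n.factorial) := by
  induction n generalizing r with
  | zero =>
    have : {x : Fin 0 → ℝ | (∀ i, 0 ≤ x i) ∧ ∑ i, x i ≤ r} = Set.univ := by
      ext x; simp [hr]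
    rw [this]
    simp [volume_pi]
  | succ n ih =>
    have hmeas : ∀ (n : ℕ) (r : ℝ),
        MeasurableSet {x : Fin n → ℝ | (∀ i, 0 ≤ x i) ∧ ∑ i, x i ≤ r} := by
      intro n r
      refine IsClosed.measurableSet ?_
      rw [Set.ofPred_and, Set.ofPred_forall]
      exact (isClosed_iInter fun i => isClosed_le continuous_const (continuous_apply i)).inter
        (isClosed_le (by fun_prop) continuous_const)
    have hmp := (volume_preserving_piFinSuccAbove (fun _ : Fin (n + 1) => ℝ) 0).symm
    rw [← hmp.measure_preimage_equiv, Measure.volume_eq_prod, Measure.prod_apply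
      ((MeasurableEquiv.measurable _) (hmeas _ _))]
    have hslice : ∀ t : ℝ, volume (Prod.mk t ⁻¹'
        ((MeasurableEquiv.piFinSuccAbove (fun _ : Fin (n + 1) => ℝ) 0).symm ⁻¹'
          {x | (∀ i, 0 ≤ x i) ∧ ∑ i, x i ≤ r})) =
        (Set.Icc 0 r).indicator (fun t => ENNReal.ofReal ((r - t) ^ n / n.factorial)) t := by
      intro t
      have hset : (Prod.mk t ⁻¹' ((MeasurableEquiv.piFinSuccAbove (fun _ : Fin (n + 1) => ℝ) 0).symm
          ⁻¹' {x | (∀ i, 0 ≤ x i) ∧ ∑ i, x i ≤ r})) =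
          {y : Fin n → ℝ | 0 ≤ t ∧ (∀ i, 0 ≤ y i) ∧ ∑ i, y i ≤ r - t} := by
        ext y
        simp [MeasurableEquiv.piFinSuccAbove, Fin.insertNthEquiv, Fin.forall_fin_succ,
          Fin.sum_univ_succ, and_assoc, le_sub_iff_add_le']
      rw [hset]
      by_cases ht : t ∈ Set.Icc 0 r
      · rw [Set.indicator_of_mem ht, ← ih (sub_nonneg.2 ht.2)]
        simp [ht.1]
      · rw [Set.indicator_of_notMem ht]
        convert measure_empty (μ := (volume : Measure (Fin n → ℝ)))
        refine Set.eq_empty_of_forall_notMem fun y hy => ht ⟨hy.1, ?_⟩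
        have := Finset.sum_nonneg fun i (_ : i ∈ Finset.univ) => hy.2.1 i
        linarith [hy.2.2]
    simp_rw [hslice]
    rw [lintegral_indicator measurableSet_Icc, ← ofReal_integral_eq_lintegral_ofReal]
    · congr 1
      rw [integral_Icc_eq_integral_Ioc, ← intervalIntegral.integral_of_le hr,
        intervalIntegral.integral_div, intervalIntegral.integral_comp_sub_left (fun t => t ^ n) r,
        integral_pow, Nat.factorial_succ]
      push_cast
      field_simp
      simp
    · exact Continuous.integrableOn_Icc (by fun_prop)
    · filter_upwards [ae_restrict_mem measurableSet_Icc] with t ht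
      have := sub_nonneg.2 ht.2
      positivity

theorem simplexOf_eq_image {d : ℕ} (P : Matrix (Fin d) (Fin (d + 1)) ℝ) :
    simplexOf P = P.mulVecLin '' stdSimplex ℝ (Fin (d + 1)) := by
  rw [← convexHull_basis_eq_stdSimplex, LinearMap.image_convexHull, ← Set.range_comp, simplexOf]
  congr 2
  ext j i
  simp [Matrix.mulVec, dotProduct]

theorem mem_simplexOf_iff {d : ℕ} (P : Matrix (Fin d) (Fin (d + 1)) ℝ) (x : Fin d → ℝ) :
    x ∈ simplexOf P ↔ ∃ w : Fin (d + 1) → ℝ, (∀ j, 0 ≤ w j) ∧ ∑ j, w j = 1 ∧ P.mulVec w = x := by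
  rw [simplexOf_eq_image]
  simp [stdSimplex, and_assoc]

/-- A matrix with a constant row put on top. -/
def borderTop {R : Type*} {d : ℕ} (c : R) (V : Matrix (Fin d) (Fin (d + 1)) R) :
    Matrix (Fin (d + 1)) (Fin (d + 1)) R :=
  Matrix.of fun i j => Fin.cases c (fun k => V k j) i

/-- A matrix with a constant column put to the left. -/
def borderLeft {R : Type*} {d : ℕ} (c : R) (U : Matrix (Fin (d + 1)) (Fin d) R) :
    Matrix (Fin (d + 1)) (Fin (d + 1)) R :=
  Matrix.of fun i j => Fin.cases c (fun k => U i k) j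

@[simp] theorem borderTop_zero {R : Type*} {d : ℕ} (c : R) (V : Matrix (Fin d) (Fin (d + 1)) R)
    (j : Fin (d + 1)) : borderTop c V 0 j = c := rfl

@[simp] theorem borderTop_succ {R : Type*} {d : ℕ} (c : R) (V : Matrix (Fin d) (Fin (d + 1)) R)
    (i : Fin d) (j : Fin (d + 1)) : borderTop c V i.succ j = V i j := rfl

@[simp] theorem borderLeft_zero {R : Type*} {d : ℕ} (c : R) (U : Matrix (Fin (d + 1)) (Fin d) R)
    (i : Fin (d + 1)) : borderLeft c U i 0 = c := rfl

@[simp] theorem borderLeft_succ {R : Type*} {d : ℕ} (c : R) (U : Matrix (Fin (d + 1)) (Fin d) R)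
    (i : Fin (d + 1)) (j : Fin d) : borderLeft c U i j.succ = U i j := rfl

theorem borderLeft_mul_borderTop {R : Type*} [CommRing R] {d : ℕ} (a b : R)
    (U : Matrix (Fin (d + 1)) (Fin d) R) (V : Matrix (Fin d) (Fin (d + 1)) R) :
    borderLeft a U * borderTop b V = Matrix.of (fun _ _ => a * b) + U * V := by
  ext i j
  simp [Matrix.mul_apply, Fin.sum_univ_succ]

/-- Subtract column 0 from the other columns, then expand along the top row. -/
theorem det_borderTop {R : Type*} [CommRing R] {d : ℕ} (V : Matrix (Fin d) (Fin (d + 1)) R) :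
    (borderTop 1 V).det = (Matrix.of fun i (j : Fin d) => V i j.succ - V i 0).det := by
  have h : (borderTop 1 V).det = (Matrix.of fun i j : Fin (d + 1) =>
      Fin.cases (borderTop 1 V i 0) (fun k => borderTop 1 V i k.succ - borderTop 1 V i 0) j).det := by
    rw [← Matrix.det_transpose, ← Matrix.det_transpose (Matrix.of _)]
    refine Matrix.det_eq_of_forall_row_eq_smul_add_const (fun j => Fin.cases 0 (fun _ => 1) j) 0
      rfl fun j i => ?_
    refine Fin.cases ?_ (fun k => ?_) j <;> simp
  rw [h, Matrix.det_succ_row_zero, Fin.sum_univ_succ]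
  simp only [Fin.val_zero, pow_zero, Matrix.of_apply, Fin.cases_zero, Fin.cases_succ,
    borderTop_zero, sub_self, mul_zero, zero_mul, Finset.sum_const_zero, add_zero, one_mul]
  congr 1

theorem normalizedVolume_simplexOf {d : ℕ} (P : Matrix (Fin d) (Fin (d + 1)) ℝ) :
    normalizedVolume (simplexOf P) = |(borderTop 1 P).det| := by
  set L : Matrix (Fin d) (Fin d) ℝ := Matrix.of fun i j => P i j.succ - P i 0 with hL
  -- Eliminating the weight of vertex 0 presents the simplex as a translate of a linear image of the
  -- corner simplex.
  have himage : simplexOf P = (fun x => (fun i => P i 0) + x) '' (L.mulVecLin ''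
      {x : Fin d → ℝ | (∀ i, 0 ≤ x i) ∧ ∑ i, x i ≤ 1}) := by
    ext x
    rw [mem_simplexOf_iff]
    simp only [Set.mem_image, Set.mem_ofPred_eq, exists_exists_and_eq_and]
    constructor
    · rintro ⟨w, hw, hs, rfl⟩
      rw [Fin.sum_univ_succ] at hs
      refine ⟨fun i => w i.succ, ⟨fun i => hw _, by linarith [hw 0]⟩, ?_⟩
      ext i
      have h0 : w 0 = 1 - ∑ j : Fin d, w j.succ := by linarith
      simp only [Pi.add_apply, Matrix.mulVecLin_apply, Matrix.mulVec, dotProduct, hL,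
        Matrix.of_apply, Fin.sum_univ_succ, h0, sub_mul, Finset.sum_sub_distrib, mul_sub,
        Finset.mul_sum]
      ring
    · rintro ⟨y, ⟨hy, hs⟩, rfl⟩
      refine ⟨Fin.cons (1 - ∑ i, y i) y, fun j => ?_, ?_, ?_⟩
      · refine Fin.cases ?_ (fun k => ?_) j
        · simpa using hs
        · simpa using hy k
      · simp [Fin.sum_univ_succ]
      · ext i
        simp only [Pi.add_apply, Matrix.mulVecLin_apply, Matrix.mulVec, dotProduct, hL,
          Matrix.of_apply, Fin.sum_univ_succ, Fin.cons_zero, Fin.cons_succ, sub_mul,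
          Finset.sum_sub_distrib, mul_sub, Finset.mul_sum]
        ring
  rw [normalizedVolume, himage, Set.image_add_left, MeasureTheory.measure_preimage_add,
    MeasureTheory.Measure.addHaar_image_linearMap, volume_corner_simplex d zero_le_one,
    det_borderTop, ← Matrix.toLin'_apply', LinearMap.det_toLin', ENNReal.toReal_mul,
    ENNReal.toReal_ofReal (abs_nonneg _), ENNReal.toReal_ofReal (by positivity)]
  have : (d.factorial : ℝ) ≠ 0 := by positivity
  field_simp
  simp [hL]

/-! ### Simplices and their duals -/

theorem nondegenerate_iff {d : ℕ} (V : Matrix (Fin d) (Fin (d + 1)) ℝ) :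
    Nondegenerate V ↔
      ∀ w : Fin (d + 1) → ℝ, ∑ j, w j = 0 → V.mulVec w = 0 → w = 0 := by
  rw [Nondegenerate, affineIndependent_iff]
  have key : ∀ (s : Finset (Fin (d + 1))) (w : Fin (d + 1) → ℝ),
      ∑ e ∈ s, w e • (fun i => V i e) = fun i => ∑ e ∈ s, V i e * w e := by
    intro s w
    ext i
    simp [mul_comm]
  constructor
  · intro h w h0 hV
    have := h Finset.univ w h0 (by rw [key]; exact hV)
    exact funext fun j => this j (Finset.mem_univ j)
  · intro h s w h0 hV e he
    have := h (fun j => if j ∈ s then w j else 0) (by simpa using h0) ?_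
    · simpa [he] using congrFun this e
    · rw [key] at hV
      ext i
      simpa [Matrix.mulVec, dotProduct] using congrFun hV i

theorem borderTop_mulVec {d : ℕ} (c : ℝ) (V : Matrix (Fin d) (Fin (d + 1)) ℝ)
    (w : Fin (d + 1) → ℝ) :
    (borderTop c V).mulVec w = Fin.cons (c * ∑ j, w j) (V.mulVec w) := by
  ext i
  refine Fin.cases ?_ (fun k => ?_) i <;> simp [Matrix.mulVec, dotProduct, Finset.mul_sum]

theorem nondegenerate_iff_det_ne_zero {d : ℕ} (V : Matrix (Fin d) (Fin (d + 1)) ℝ) :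
    Nondegenerate V ↔ (borderTop 1 V).det ≠ 0 := by
  rw [nondegenerate_iff, ← not_iff_not, not_not, ← Matrix.exists_mulVec_eq_zero_iff]
  push Not
  have hcons : ∀ w : Fin (d + 1) → ℝ, (borderTop 1 V).mulVec w = 0 ↔
      ∑ j, w j = 0 ∧ V.mulVec w = 0 := by
    intro w
    rw [borderTop_mulVec, one_mul]
    constructor
    · intro h
      exact ⟨by simpa using congrFun h 0, funext fun k => by simpa using congrFun h k.succ⟩
    · rintro ⟨h1, h2⟩
      rw [h1, h2]
      ext i
      refine Fin.cases ?_ (fun k => ?_) i <;> simp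
  simp only [hcons]
  exact exists_congr fun w => by tauto

theorem zero_mem_interior_iff {d : ℕ} {V : Matrix (Fin d) (Fin (d + 1)) ℝ} (hV : Nondegenerate V) :
    (0 : Fin d → ℝ) ∈ interior (simplexOf V) ↔
      ∃ β : Fin (d + 1) → ℝ, (∀ j, 0 < β j) ∧ ∑ j, β j = 1 ∧ V.mulVec β = 0 := by
  let b : AffineBasis (Fin (d + 1)) ℝ (Fin d → ℝ) :=
    ⟨fun j i => V i j, hV, by rw [hV.affineSpan_eq_top_iff_card_eq_finrank_add_one]; simp⟩
  have hb : ∀ j, b j = fun i => V i j := fun j => rfl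
  have hint : interior (simplexOf V) = {x | ∀ i, 0 < b.coord i x} := b.interior_convexHull
  have hcomb : ∀ w : Fin (d + 1) → ℝ, ∑ j, w j • b j = V.mulVec w := by
    intro w
    ext i
    simp [hb, Matrix.mulVec, dotProduct, mul_comm]
  rw [hint]
  constructor
  · intro h
    refine ⟨fun j => b.coord j 0, h, b.sum_coord_apply_eq_one 0, ?_⟩
    rw [← hcomb]
    exact b.linear_combination_coord_eq_self 0
  · rintro ⟨β, hpos, hsum, hzero⟩ j
    rw [← hcomb, ← Finset.univ.affineCombination_eq_linear_combination _ _ hsum] at hzero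
    rw [← hzero]
    exact (hpos j).trans_eq (b.coord_apply_combination_of_mem (Finset.mem_univ j) hsum).symm

/-- The rows `U i` are `g` times the vertices of the dual of the simplex with vertices the columns
of `V`: they pair to `-g` with all columns but the `i`-th, and to `A i - g` with the `i`-th. -/
def IsDualPair {R : Type*} [CommRing R] {d : ℕ} (V : Matrix (Fin d) (Fin (d + 1)) R)
    (U : Matrix (Fin (d + 1)) (Fin d) R) (A : Fin (d + 1) → R) (g : R) : Prop :=
  U * V = Matrix.diagonal A - Matrix.of fun _ _ => g

namespace IsDualPair

section CommRing

variable {R : Type*} [CommRing R] {d : ℕ} {V : Matrix (Fin d) (Fin (d + 1)) R}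
  {U : Matrix (Fin (d + 1)) (Fin d) R} {A : Fin (d + 1) → R} {g : R}

theorem border_mul (h : IsDualPair V U A g) :
    borderLeft g U * borderTop 1 V = Matrix.diagonal A := by
  rw [borderLeft_mul_borderTop, h]
  ext i j
  simp

theorem border_mul' (h : IsDualPair V U A g) :
    borderLeft 1 U * borderTop g V = Matrix.diagonal A := by
  rw [borderLeft_mul_borderTop, h]
  ext i j
  simp

theorem apply (h : IsDualPair V U A g) (i j : Fin (d + 1)) :
    ∑ k, U i k * V k j = (if i = j then A i else 0) - g := by
  have := congrFun (congrFun h i) j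
  simpa [Matrix.mul_apply, Matrix.diagonal_apply] using this

end CommRing

variable {d : ℕ} {V : Matrix (Fin d) (Fin (d + 1)) ℝ} {U : Matrix (Fin (d + 1)) (Fin d) ℝ}
  {A : Fin (d + 1) → ℝ} {g : ℝ}

/-- The four blocks of this identity are `sum_inv`, `sum_mul_inv`, `sum_inv_mul` and `sum_mul_mul`.
-/
theorem border_inv (h : IsDualPair V U A g) (hA : ∀ i, 0 < A i) :
    borderTop 1 V * (Matrix.diagonal (fun i => 1 / A i) * borderLeft g U) = 1 := by
  rw [mul_eq_one_comm, Matrix.mul_assoc, h.border_mul, Matrix.diagonal_mul_diagonal]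
  simp [(hA _).ne']

theorem nondegenerate (h : IsDualPair V U A g) (hA : ∀ i, 0 < A i) : Nondegenerate V := by
  rw [nondegenerate_iff_det_ne_zero]
  intro h0
  have := congrArg Matrix.det (h.border_inv hA)
  rw [Matrix.det_mul, h0, zero_mul, Matrix.det_one] at this
  exact zero_ne_one this

theorem sum_inv (h : IsDualPair V U A g) (hA : ∀ i, 0 < A i) : (∑ j, 1 / A j) * g = 1 := by
  have := congrFun (congrFun (h.border_inv hA) 0) 0
  rw [Matrix.mul_apply] at this
  simpa [Matrix.diagonal_mul, Finset.sum_mul] using this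

theorem sum_mul_inv (h : IsDualPair V U A g) (hA : ∀ i, 0 < A i) (hg : 0 < g) (k : Fin d) :
    ∑ j, V k j / A j = 0 := by
  have := congrFun (congrFun (h.border_inv hA) k.succ) 0
  rw [Matrix.mul_apply] at this
  simp only [borderTop_succ, Matrix.diagonal_mul, borderLeft_zero, ← mul_assoc,
    ← Finset.sum_mul] at this
  rw [Matrix.one_apply_ne (Fin.succ_ne_zero k), mul_eq_zero] at this
  simpa [div_eq_mul_inv] using this.resolve_right hg.ne'

theorem sum_inv_mul (h : IsDualPair V U A g) (hA : ∀ i, 0 < A i) (k : Fin d) :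
    ∑ j, U j k / A j = 0 := by
  have := congrFun (congrFun (h.border_inv hA) 0) k.succ
  rw [Matrix.mul_apply, Matrix.one_apply_ne (Fin.succ_ne_zero k).symm] at this
  simpa [Matrix.diagonal_mul, div_eq_inv_mul] using this

theorem sum_mul_mul (h : IsDualPair V U A g) (hA : ∀ i, 0 < A i) (k l : Fin d) :
    ∑ j, V k j * U j l / A j = if k = l then 1 else 0 := by
  have := congrFun (congrFun (h.border_inv hA) k.succ) l.succ
  rw [Matrix.mul_apply, Matrix.one_apply] at this
  simp only [borderTop_succ, Matrix.diagonal_mul, borderLeft_succ, Fin.succ_inj] at this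
  rw [← this]
  exact Finset.sum_congr rfl fun j _ => by ring

theorem sum_vecMul_div (h : IsDualPair V U A g) (hA : ∀ i, 0 < A i) (x : Fin d → ℝ) (l : Fin d) :
    ∑ j, (Matrix.vecMul x V) j / A j * U j l = x l := by
  have h1 : ∀ j, (Matrix.vecMul x V) j / A j * U j l = ∑ k, x k * (V k j * U j l / A j) := by
    intro j
    rw [Matrix.vecMul, dotProduct, Finset.sum_div, Finset.sum_mul]
    exact Finset.sum_congr rfl fun k _ => by ring
  simp_rw [h1]
  rw [Finset.sum_comm]
  simp_rw [← Finset.mul_sum, h.sum_mul_mul hA]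
  simp

theorem sum_vecMul_inv (h : IsDualPair V U A g) (hA : ∀ i, 0 < A i) (hg : 0 < g)
    (x : Fin d → ℝ) : ∑ j, (Matrix.vecMul x V) j / A j = 0 := by
  have h1 : ∀ j, (Matrix.vecMul x V) j / A j = ∑ k, x k * (V k j / A j) := by
    intro j
    rw [Matrix.vecMul, dotProduct, Finset.sum_div]
    exact Finset.sum_congr rfl fun k _ => by ring
  simp_rw [h1]
  rw [Finset.sum_comm]
  simp_rw [← Finset.mul_sum, h.sum_mul_inv hA hg]
  simp

theorem zero_mem_interior (h : IsDualPair V U A g) (hA : ∀ i, 0 < A i) (hg : 0 < g) :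
    (0 : Fin d → ℝ) ∈ interior (simplexOf V) := by
  rw [zero_mem_interior_iff (h.nondegenerate hA)]
  refine ⟨fun j => g / A j, fun j => div_pos hg (hA j), ?_, ?_⟩
  · rw [← h.sum_inv hA, Finset.sum_mul]
    exact Finset.sum_congr rfl fun j _ => by ring
  · ext k
    have := h.sum_mul_inv hA hg k
    calc V.mulVec (fun j => g / A j) k = g * ∑ j, V k j / A j := by
          rw [Matrix.mulVec, dotProduct, Finset.mul_sum]
          exact Finset.sum_congr rfl fun j _ => by ring
      _ = 0 := by rw [this, mul_zero]

end IsDualPair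

theorem exists_isDualPair {d : ℕ} {V : Matrix (Fin d) (Fin (d + 1)) ℝ} (hV : Nondegenerate V)
    (h0 : (0 : Fin d → ℝ) ∈ interior (simplexOf V)) {g : ℝ} (hg : 0 < g) :
    ∃ (U : Matrix (Fin (d + 1)) (Fin d) ℝ) (A : Fin (d + 1) → ℝ),
      (∀ j, 0 < A j) ∧ IsDualPair V U A g := by
  obtain ⟨β, hβ, hs, hz⟩ := (zero_mem_interior_iff hV).1 h0
  have hdet := (nondegenerate_iff_det_ne_zero V).1 hV
  set N := (borderTop 1 V)⁻¹ with hN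
  have hNV : N * borderTop 1 V = 1 := Matrix.nonsing_inv_mul _ (isUnit_iff_ne_zero.2 hdet)
  have hN0 : ∀ i, N i 0 = β i := by
    intro i
    have h1 : (borderTop 1 V).mulVec β = Pi.single 0 1 := by
      rw [borderTop_mulVec, hs, hz]
      ext k
      refine Fin.cases ?_ (fun k => ?_) k <;> simp
    have h2 := congrArg (fun w => N.mulVec w i) h1
    simp only [Matrix.mulVec_mulVec, hNV, Matrix.one_mulVec] at h2
    rw [h2]
    simp
  -- Column 0 of the inverse of the bordered matrix consists of the barycentric coordinates β of the
  -- origin. Scaling row i by g / β_i makes that column constant equal to g; the remaining columns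
  -- form U, and A_i = g / β_i.
  refine ⟨Matrix.of fun i k => g / β i * N i k.succ, fun i => g / β i,
    fun j => div_pos hg (hβ j), ?_⟩
  ext i j
  have h1 := congrFun (congrFun hNV i) j
  rw [Matrix.mul_apply, Fin.sum_univ_succ, hN0, borderTop_zero, mul_one] at h1
  simp only [borderTop_succ] at h1
  rw [Matrix.mul_apply, Matrix.sub_apply, Matrix.diagonal_apply, Matrix.of_apply]
  simp only [Matrix.of_apply, mul_assoc, ← Finset.mul_sum]
  have h2 : ∑ k, N i (Fin.succ k) * V k j = (1 : Matrix _ _ ℝ) i j - β i := by linarith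
  rw [h2, Matrix.one_apply]
  have := (hβ i).ne'
  split_ifs <;> (field_simp; try ring)

theorem smul_dualPolytope {d : ℕ} (V : Matrix (Fin d) (Fin (d + 1)) ℝ) {k : ℝ} (hk : 0 < k) :
    k • dualPolytope (simplexOf V) = {x | ∀ j, -k ≤ (Matrix.vecMul x V) j} := by
  ext x
  rw [Set.mem_smul_set_iff_inv_smul_mem₀ hk.ne']
  have hcol : ∀ j, (fun i => V i j) ∈ simplexOf V := fun j => subset_convexHull _ _ ⟨j, rfl⟩
  have hdot : ∀ w, (k⁻¹ • x) ⬝ᵥ V.mulVec w = k⁻¹ * (Matrix.vecMul x V ⬝ᵥ w) := by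
    intro w
    rw [smul_dotProduct, Matrix.dotProduct_mulVec, smul_eq_mul]
  constructor
  · intro h j
    have := h _ (hcol j)
    rw [smul_dotProduct, smul_eq_mul] at this
    have h2 : -1 ≤ k⁻¹ * (Matrix.vecMul x V) j := this
    rw [inv_mul_eq_div, le_div_iff₀ hk] at h2
    linarith
  · intro h v hv
    obtain ⟨w, hw, hs, rfl⟩ := (mem_simplexOf_iff V v).1 hv
    rw [hdot, inv_mul_eq_div, le_div_iff₀ hk, neg_one_mul, dotProduct]
    calc -k = ∑ j, -k * w j := by rw [← Finset.mul_sum, hs, mul_one]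
      _ ≤ _ := Finset.sum_le_sum fun j _ => mul_le_mul_of_nonneg_right (h j) (hw j)

namespace IsDualPair

variable {d : ℕ} {V : Matrix (Fin d) (Fin (d + 1)) ℝ} {U : Matrix (Fin (d + 1)) (Fin d) ℝ}
  {A : Fin (d + 1) → ℝ} {g : ℝ}

theorem vecMul_row (h : IsDualPair V U A g) (i j : Fin (d + 1)) :
    (Matrix.vecMul (U i) V) j = (if i = j then A i else 0) - g := h.apply i j

/-- Among the points (k/g) u_i, the affine function ⟨x, v_j⟩ + k vanishes at all but the j-th.
Suitably normalized it is the j-th barycentric coordinate, which is the weight used below. -/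
theorem smul_dualPolytope_eq (h : IsDualPair V U A g) (hA : ∀ i, 0 < A i) (hg : 0 < g) {k : ℝ}
    (hk : 0 < k) :
    k • dualPolytope (simplexOf V) = simplexOf ((k / g) • U.transpose) := by
  rw [smul_dualPolytope V hk]
  ext x
  rw [mem_simplexOf_iff]
  constructor
  · intro hx
    refine ⟨fun j => g / k * (((Matrix.vecMul x V) j + k) / A j), fun j => ?_, ?_, ?_⟩
    · exact mul_nonneg (div_pos hg hk).le (div_nonneg (by linarith [hx j]) (hA j).le)
    · simp only [add_div, ← Finset.mul_sum, Finset.sum_add_distrib, h.sum_vecMul_inv hA hg]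
      have h1 := h.sum_inv hA
      have h2 : ∑ j, k / A j = k * ∑ j, 1 / A j := by
        rw [Finset.mul_sum]
        exact Finset.sum_congr rfl fun j _ => by ring
      rw [h2]
      field_simp
      linear_combination k * h1
    · ext l
      have h1 := h.sum_vecMul_div hA x l
      have h2 := h.sum_inv_mul hA l
      simp only [Matrix.mulVec, dotProduct, Matrix.smul_apply, Matrix.transpose_apply, smul_eq_mul]
      calc _ = ∑ j, ((Matrix.vecMul x V) j / A j * U j l + k * (U j l / A j)) :=
            Finset.sum_congr rfl fun j _ => by field_simp
        _ = x l := by rw [Finset.sum_add_distrib, ← Finset.mul_sum, h1, h2, mul_zero, add_zero]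
  · rintro ⟨w, hw, hs, rfl⟩ j
    have h1 : Matrix.vecMul (((k / g) • U.transpose).mulVec w) V j =
        k / g * (w j * A j - g) := by
      have h2 : ((k / g) • U.transpose).mulVec w = (k / g) • Matrix.vecMul w U := by
        rw [Matrix.smul_mulVec, Matrix.mulVec_transpose]
      rw [h2, Matrix.smul_vecMul, Matrix.vecMul_vecMul, Pi.smul_apply, smul_eq_mul, h,
        Matrix.vecMul, dotProduct]
      simp only [Matrix.sub_apply, Matrix.of_apply, mul_sub, Finset.sum_sub_distrib,
        ← Finset.sum_mul, hs, Matrix.diagonal_apply]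
      simp
    rw [h1, div_mul_eq_mul_div, le_div_iff₀ hg]
    nlinarith [mul_nonneg hk.le (mul_nonneg (hw j) (hA j).le)]

theorem nondegenerate_transpose (h : IsDualPair V U A g) (hA : ∀ i, 0 < A i) {c : ℝ}
    (hc : c ≠ 0) : Nondegenerate (c • U.transpose) := by
  rw [nondegenerate_iff]
  intro w hs hw
  rw [Matrix.smul_mulVec, Matrix.mulVec_transpose] at hw
  have hw' := (smul_eq_zero.1 hw).resolve_left hc
  have h1 := congrArg (fun x => Matrix.vecMul x V) hw'
  simp only [Matrix.vecMul_vecMul, Matrix.zero_vecMul] at h1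
  rw [h] at h1
  ext j
  have h2 := congrFun h1 j
  rw [Matrix.vecMul, dotProduct] at h2
  simp only [Matrix.sub_apply, Matrix.of_apply, mul_sub, Finset.sum_sub_distrib,
    ← Finset.sum_mul, hs, Matrix.diagonal_apply] at h2
  simpa [(hA j).ne'] using h2

/-- At this point all inequalities but the i-th are tight, and the relation ∑ ⟨x, v_j⟩ / A_j = 0
then fixes the i-th pairing as well. -/
theorem smul_row_mem_extremePoints (h : IsDualPair V U A g) (hA : ∀ i, 0 < A i) (hg : 0 < g)
    {k : ℝ} (hk : 0 < k) (i : Fin (d + 1)) :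
    (k / g) • U i ∈ (k • dualPolytope (simplexOf V)).extremePoints ℝ := by
  rw [smul_dualPolytope V hk]
  have hrow : ∀ j, Matrix.vecMul ((k / g) • U i) V j = k / g * ((if i = j then A i else 0) - g) :=
    fun j => by rw [Matrix.smul_vecMul, Pi.smul_apply, h.vecMul_row, smul_eq_mul]
  rw [mem_extremePoints_iff_left]
  refine ⟨fun j => ?_, ?_⟩
  · rw [hrow, div_mul_eq_mul_div, le_div_iff₀ hg]
    split_ifs
    · nlinarith [mul_pos hk (hA i)]
    · linarith
  · rintro x hx y hy ⟨a, b, ha, hb, hab, hxy⟩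
    have hne : ∀ j, j ≠ i → Matrix.vecMul x V j = Matrix.vecMul ((k / g) • U i) V j := by
      intro j hj
      have h1 := hrow j
      rw [if_neg hj.symm, zero_sub, mul_neg, div_mul_cancel₀ _ hg.ne'] at h1
      rw [h1]
      rw [← hxy, Matrix.add_vecMul, Matrix.smul_vecMul, Matrix.smul_vecMul, Pi.add_apply,
        Pi.smul_apply, Pi.smul_apply, smul_eq_mul, smul_eq_mul] at h1
      refine le_antisymm ?_ (hx j)
      have h2 : b * (-k) ≤ b * Matrix.vecMul y V j := mul_le_mul_of_nonneg_left (hy j) hb.le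
      have h3 : a * Matrix.vecMul x V j ≤ a * (-k) := by
        have : (a + b) * (-k) = -k := by rw [hab, one_mul]
        linarith
      exact le_of_mul_le_mul_left h3 ha
    have hall : ∀ j, Matrix.vecMul x V j = Matrix.vecMul ((k / g) • U i) V j := by
      intro j
      by_cases hj : j = i
      · subst hj
        have h1 := h.sum_vecMul_inv hA hg x
        have h2 := h.sum_vecMul_inv hA hg ((k / g) • U j)
        rw [← Finset.add_sum_erase _ _ (Finset.mem_univ j)] at h1 h2
        rw [Finset.sum_congr rfl fun l hl => by rw [hne l (Finset.ne_of_mem_erase hl)]] at h1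
        have h3 := h1.trans h2.symm
        exact (div_left_inj' (hA j).ne').1 (add_right_cancel h3)
      · exact hne j hj
    ext l
    rw [← h.sum_vecMul_div hA x l, ← h.sum_vecMul_div hA ((k / g) • U i) l]
    simp_rw [hall]

end IsDualPair

/-! ### The Gorenstein index and integral dual pairs -/

theorem toRealMatrix_mul {l m n : ℕ} (P : Matrix (Fin l) (Fin m) ℤ) (Q : Matrix (Fin m) (Fin n) ℤ) :
    toRealMatrix (P * Q) = toRealMatrix P * toRealMatrix Q :=
  Matrix.map_mul (f := Int.castRingHom ℝ)

@[simp] theorem toRealMatrix_apply {m n : ℕ} (P : Matrix (Fin m) (Fin n) ℤ) (i : Fin m)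
    (j : Fin n) : toRealMatrix P i j = (P i j : ℝ) := rfl

theorem toRealMatrix_injective {m n : ℕ} : Function.Injective (toRealMatrix (m := m) (n := n)) := by
  intro P Q h
  ext i j
  have := congrFun (congrFun h i) j
  simpa using this

theorem isDualPair_toRealMatrix {d : ℕ} {V : Matrix (Fin d) (Fin (d + 1)) ℤ}
    {U : Matrix (Fin (d + 1)) (Fin d) ℤ} {A : Fin (d + 1) → ℤ} {g : ℤ} :
    IsDualPair (toRealMatrix V) (toRealMatrix U) (fun i => (A i : ℝ)) g ↔ IsDualPair V U A g := by
  rw [IsDualPair, IsDualPair, ← toRealMatrix_mul, ← toRealMatrix_injective.eq_iff]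
  refine Eq.congr_right ?_
  ext i j
  simp only [Matrix.sub_apply, Matrix.diagonal_apply, Matrix.of_apply, toRealMatrix_apply]
  split_ifs <;> simp

theorem rationalityIndex_eq_one {d : ℕ} {S : Set (Fin d → ℝ)} (h : IsLatticeSimplex S) :
    rationalityIndex S = 1 := by
  have h1 : 1 ∈ {k : ℕ | 1 ≤ k ∧ IsLatticeSimplex ((k : ℝ) • S)} := by simpa using h
  exact le_antisymm (Nat.sInf_le h1) (Nat.sInf_mem ⟨1, h1⟩).1

theorem IsFanoSimplex.isLatticeSimplex {d : ℕ} {S : Set (Fin d → ℝ)} (h : IsFanoSimplex S) :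
    IsLatticeSimplex S := by
  obtain ⟨P, hP, -, hS, -⟩ := h
  exact ⟨P, hP, hS⟩

/-- Extreme points do not depend on the matrix presenting the simplex, so they occur among the
columns of any integral presentation. -/
theorem IsDualPair.isLatticeSimplex_smul_dualPolytope_iff {d : ℕ}
    {V : Matrix (Fin d) (Fin (d + 1)) ℝ} {U : Matrix (Fin (d + 1)) (Fin d) ℝ}
    {A : Fin (d + 1) → ℝ} {g k : ℝ} (h : IsDualPair V U A g) (hA : ∀ i, 0 < A i) (hg : 0 < g)
    (hk : 0 < k) :
    IsLatticeSimplex (k • dualPolytope (simplexOf V)) ↔ ∀ i l, ∃ z : ℤ, k / g * U i l = z := by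
  constructor
  · rintro ⟨Q, -, hQ⟩ i l
    have hmem := h.smul_row_mem_extremePoints hA hg hk i
    rw [hQ, simplexOf] at hmem
    obtain ⟨j, hj⟩ := extremePoints_convexHull_subset hmem
    exact ⟨Q l j, by simpa using (congrFun hj l).symm⟩
  · intro hz
    choose z hz using hz
    have hQ : toRealMatrix (Matrix.of fun l i => z i l) = (k / g) • U.transpose := by
      ext l i
      simp [hz]
    refine ⟨Matrix.of fun l i => z i l, ?_, ?_⟩
    · rw [hQ]
      exact h.nondegenerate_transpose hA (div_pos hk hg).ne'
    · rw [hQ]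
      exact h.smul_dualPolytope_eq hA hg hk

theorem IsFanoSimplex.exists_isDualPair {d g : ℕ} {S : Set (Fin d → ℝ)} (hS : IsFanoSimplex S)
    (hg : 1 ≤ g) (hgor : gorensteinIndex S = g) :
    ∃ (V : Matrix (Fin d) (Fin (d + 1)) ℤ) (U : Matrix (Fin (d + 1)) (Fin d) ℤ)
      (A : Fin (d + 1) → ℤ), (∀ j, 0 < A j) ∧ (∀ j, IsPrimitivePoint fun i => V i j) ∧
      IsDualPair V U A g ∧ S = simplexOf (toRealMatrix V) := by
  rw [gorensteinIndex, rationalityIndex_eq_one hS.isLatticeSimplex, one_mul] at hgor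
  have hmem : g ∈ {k : ℕ | 1 ≤ k ∧ IsLatticeSimplex ((k : ℝ) • dualPolytope S)} := by
    rw [← hgor]
    -- The infimum of the empty set of naturals is 0, so g ≥ 1 guarantees that some multiple of the
    -- dual is a lattice simplex.
    refine Nat.sInf_mem (Set.nonempty_iff_ne_empty.2 fun h => ?_)
    rw [rationalityIndex, h, Nat.sInf_empty] at hgor
    omega
  obtain ⟨V, hV, hprim, rfl, h0⟩ := hS
  have hg' : (0 : ℝ) < g := by exact_mod_cast hg
  obtain ⟨U, A, hA, hUV⟩ := _root_.exists_isDualPair hV h0 hg'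
  have hint := (hUV.isLatticeSimplex_smul_dualPolytope_iff hA hg' hg').1 hmem.2
  simp only [div_self hg'.ne', one_mul] at hint
  choose Z hZ using hint
  have hU : U = toRealMatrix (Matrix.of Z) := by
    ext i l
    simp [hZ]
  have hAZ : ∀ i, A i = ((g + ∑ k, Z i k * V k i : ℤ) : ℝ) := by
    intro i
    have := hUV.apply i i
    rw [if_pos rfl] at this
    push_cast
    simp only [hZ, toRealMatrix_apply] at this
    linarith
  refine ⟨V, Matrix.of Z, fun i => g + ∑ k, Z i k * V k i, fun j => ?_, hprim, ?_, rfl⟩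
  · have := hA j
    rw [hAZ] at this
    exact_mod_cast this
  · rw [← isDualPair_toRealMatrix, ← hU]
    have hA' : A = fun i => ((g + ∑ k, Z i k * V k i : ℤ) : ℝ) := funext hAZ
    rw [← hA']
    exact_mod_cast hUV

section Integral

variable {d g : ℕ} {V : Matrix (Fin d) (Fin (d + 1)) ℤ} {U : Matrix (Fin (d + 1)) (Fin d) ℤ}
  {A : Fin (d + 1) → ℤ}

theorem IsDualPair.real (h : IsDualPair V U A (g : ℤ)) :
    IsDualPair (toRealMatrix V) (toRealMatrix U) (fun i => (A i : ℝ)) (g : ℝ) := by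
  have := isDualPair_toRealMatrix.2 h
  exact_mod_cast this

theorem IsDualPair.isFanoSimplex (h : IsDualPair V U A (g : ℤ)) (hA : ∀ j, 0 < A j) (hg : 1 ≤ g)
    (hprim : ∀ j, IsPrimitivePoint fun i => V i j) : IsFanoSimplex (simplexOf (toRealMatrix V)) := by
  have hA' : ∀ i, (0 : ℝ) < A i := fun i => by exact_mod_cast hA i
  exact ⟨V, h.real.nondegenerate hA', hprim, rfl,
    h.real.zero_mem_interior hA' (by exact_mod_cast hg)⟩

/-- If the k-fold dual is integral, then g divides k U_{il}; coprimality turns this into g ∣ k. -/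
theorem IsDualPair.gorensteinIndex_eq (h : IsDualPair V U A (g : ℤ)) (hA : ∀ j, 0 < A j)
    (hg : 1 ≤ g) {i : Fin (d + 1)} {l : Fin d} (hcop : IsCoprime (g : ℤ) (U i l)) :
    gorensteinIndex (simplexOf (toRealMatrix V)) = g := by
  have hA' : ∀ i, (0 : ℝ) < A i := fun i => by exact_mod_cast hA i
  have hg' : (0 : ℝ) < g := by exact_mod_cast hg
  rw [gorensteinIndex, rationalityIndex_eq_one ⟨V, h.real.nondegenerate hA', rfl⟩, one_mul]
  have hmem : g ∈ {k : ℕ | 1 ≤ k ∧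
      IsLatticeSimplex ((k : ℝ) • dualPolytope (simplexOf (toRealMatrix V)))} := by
    refine ⟨hg, (h.real.isLatticeSimplex_smul_dualPolytope_iff hA' hg' hg').2 fun i l =>
      ⟨U i l, ?_⟩⟩
    rw [div_self hg'.ne', one_mul, toRealMatrix_apply]
  refine le_antisymm (Nat.sInf_le hmem) ?_
  obtain ⟨hk, hlat⟩ := Nat.sInf_mem (s := {k : ℕ | 1 ≤ k ∧
      IsLatticeSimplex ((k : ℝ) • dualPolytope (simplexOf (toRealMatrix V)))}) ⟨g, hmem⟩
  set k := sInf {k : ℕ | 1 ≤ k ∧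
      IsLatticeSimplex ((k : ℝ) • dualPolytope (simplexOf (toRealMatrix V)))}
  have hk' : (0 : ℝ) < k := by exact_mod_cast hk
  obtain ⟨z, hz⟩ := (h.real.isLatticeSimplex_smul_dualPolytope_iff hA' hg' hk').1 hlat i l
  have hdvd : (g : ℤ) ∣ k * U i l := by
    refine ⟨z, ?_⟩
    rw [toRealMatrix_apply] at hz
    field_simp at hz
    exact_mod_cast hz
  have := Int.le_of_dvd (by exact_mod_cast hk) (hcop.dvd_of_dvd_mul_right hdvd)
  show g ≤ k
  exact_mod_cast this

theorem normalizedVolume_toRealMatrix (V : Matrix (Fin d) (Fin (d + 1)) ℤ) :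
    normalizedVolume (simplexOf (toRealMatrix V)) = (|(borderTop 1 V).det| : ℤ) := by
  rw [normalizedVolume_simplexOf, Int.cast_abs]
  congr 1
  have : borderTop 1 (toRealMatrix V) = (Int.castRingHom ℝ).mapMatrix (borderTop 1 V) := by
    ext i j
    refine Fin.cases ?_ (fun k => ?_) i <;> simp
  rw [this, ← RingHom.map_det]
  rfl

theorem simplexOf_submatrix (P : Matrix (Fin d) (Fin (d + 1)) ℝ)
    (σ : Equiv.Perm (Fin (d + 1))) : simplexOf (P.submatrix id σ) = simplexOf P := by
  rw [simplexOf, simplexOf, ← σ.surjective.range_comp (fun j i => P i j)]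
  rfl

theorem IsDualPair.submatrix {R : Type*} [CommRing R] {V : Matrix (Fin d) (Fin (d + 1)) R}
    {U : Matrix (Fin (d + 1)) (Fin d) R} {A : Fin (d + 1) → R} {g : R}
    (h : IsDualPair V U A g) (σ : Equiv.Perm (Fin (d + 1))) :
    IsDualPair (V.submatrix id σ) (U.submatrix σ id) (A ∘ σ) g := by
  ext i j
  have h1 : (U.submatrix σ id * V.submatrix id σ) i j = (U * V) (σ i) (σ j) := by
    simp [Matrix.mul_apply]
  rw [h1, h]
  simp [Matrix.diagonal_apply]

/-! ### Consequences of primitive vertices for the dual determinant. -/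

/-- The entries of a primitive point generate the unit ideal. -/
theorem IsPrimitivePoint.exists_sum_mul_eq_one {v : Fin d → ℤ} (hv : IsPrimitivePoint v) :
    ∃ m : Fin d → ℤ, ∑ k, m k * v k = 1 := by
  rw [← Ideal.mem_span_range_iff_exists_fun, ← Ideal.eq_top_iff_one]
  set I := Ideal.span (Set.range v)
  have hdvd : ∀ k, Submodule.IsPrincipal.generator I ∣ v k := fun k =>
    (Submodule.IsPrincipal.mem_iff_generator_dvd I).1 (Ideal.subset_span ⟨k, rfl⟩)
  choose w hw using hdvd
  have hu := hv (Submodule.IsPrincipal.generator I) w (funext hw)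
  exact Ideal.eq_top_of_isUnit_mem _ (Submodule.IsPrincipal.generator_mem I) hu

theorem IsDualPair.det_mul_borderTop (h : IsDualPair V U A (g : ℤ)) (k i : Fin (d + 1)) :
    (borderLeft 1 U).det * borderTop (g : ℤ) V k i = (borderLeft 1 U).adjugate k i * A i := by
  have h1 := congrArg (fun M => (borderLeft 1 U).adjugate * M) h.border_mul'
  simp only [← Matrix.mul_assoc, Matrix.adjugate_mul, Matrix.smul_mul, Matrix.one_mul] at h1
  have := congrFun (congrFun h1 k) i
  simpa [Matrix.mul_diagonal] using this

/-- By Cramer's rule A_i divides every entry of det · v_i, and the entries of v_i have an integral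
combination equal to 1. Geometrically, A_i is the lattice distance of u_i from the opposite facet of
gΔ*. -/
theorem IsDualPair.dvd_det (h : IsDualPair V U A (g : ℤ)) {i : Fin (d + 1)}
    (hprim : IsPrimitivePoint fun k => V k i) : A i ∣ (borderLeft 1 U).det := by
  obtain ⟨m, hm⟩ := hprim.exists_sum_mul_eq_one
  have : (borderLeft 1 U).det = ∑ k, m k * ((borderLeft 1 U).det * V k i) := by
    calc _ = (borderLeft 1 U).det * ∑ k, m k * V k i := by rw [hm, mul_one]
      _ = _ := by
        rw [Finset.mul_sum]
        exact Finset.sum_congr rfl fun k _ => by ring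
  rw [this]
  refine Finset.dvd_sum fun k _ => Dvd.dvd.mul_left ?_ _
  have := h.det_mul_borderTop k.succ i
  rw [borderTop_succ] at this
  exact ⟨_, this.trans (mul_comm _ _)⟩

theorem IsDualPair.det_mul_det (h : IsDualPair V U A (g : ℤ)) :
    g * (borderLeft 1 U).det * (borderTop 1 V).det = ∏ i, A i := by
  have h1 := congrArg Matrix.det h.border_mul
  rw [Matrix.det_mul, Matrix.det_diagonal] at h1
  rw [← h1]
  congr 1
  have : borderLeft (g : ℤ) U = borderLeft 1 U * Matrix.diagonal (Fin.cons (g : ℤ) fun _ => 1) := by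
    ext i j
    rw [Matrix.mul_diagonal]
    refine Fin.cases ?_ (fun k => ?_) j <;> simp
  rw [this, Matrix.det_mul, Matrix.det_diagonal, Fin.prod_univ_succ]
  simp [mul_comm]

theorem IsDualPair.sum_inv_eq (h : IsDualPair V U A (g : ℤ)) (hA : ∀ j, 0 < A j) (hg : 1 ≤ g) :
    ∑ j, 1 / (A j : ℝ) = 1 / g := by
  have hA' : ∀ i, (0 : ℝ) < A i := fun i => by exact_mod_cast hA i
  have hg' : (0 : ℝ) < g := by exact_mod_cast hg
  rw [eq_div_iff hg'.ne']
  exact h.real.sum_inv hA'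

/-- Modulo `A j`, the points `(g, v_j)` and `n • (g, v_i)` agree, because the facet opposite to
the `i`-th vertex of the dual is unimodular. -/
theorem IsDualPair.exists_dvd_sub (h : IsDualPair V U A (g : ℤ)) {i : Fin (d + 1)}
    (hAi : A i ≠ 0) (hprim : IsPrimitivePoint fun k => V k i)
    (hdet : |(borderLeft 1 U).det| = A i) {j : Fin (d + 1)} (hij : i ≠ j) :
    ∃ n : ℤ, A j ∣ g - n * g ∧ ∀ k, A j ∣ V k j - n * V k i := by
  obtain ⟨m, hm⟩ := hprim.exists_sum_mul_eq_one
  obtain ⟨ε, hε, hdetε⟩ : ∃ ε : ℤ, ε * ε = 1 ∧ (borderLeft 1 U).det = ε * A i := by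
    rcases abs_choice (borderLeft 1 U).det with h1 | h1
    · exact ⟨1, by norm_num, by rw [← hdet, h1, one_mul]⟩
    · exact ⟨-1, by norm_num, by rw [← hdet, h1]; ring⟩
  -- The i-th row (1, u_i) is replaced by (0, m), where m pairs to 1 with v_i. Column i of the
  -- adjugate is ε (g, v_i), so the new determinant is ε = ±1.
  set N := (borderLeft 1 U).updateRow i (Fin.cons 0 m) with hN
  have hadj : ∀ k, (borderLeft 1 U).adjugate k i = ε * borderTop (g : ℤ) V k i := by
    intro k
    have := h.det_mul_borderTop k i
    rw [hdetε] at this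
    refine mul_right_cancel₀ hAi ?_
    linear_combination -this
  have hNdet : N.det = ε := by
    have h2 : N.det = ∑ k, (Fin.cons 0 m : Fin (d + 1) → ℤ) k * (borderLeft 1 U).adjugate k i := by
      rw [hN, ← Matrix.cramer_transpose_apply, Matrix.cramer_eq_adjugate_mulVec,
        ← Matrix.adjugate_transpose, Matrix.mulVec, dotProduct]
      exact Finset.sum_congr rfl fun k _ => mul_comm _ _
    rw [h2]
    simp only [hadj, Fin.sum_univ_succ, Fin.cons_zero, Fin.cons_succ, borderTop_succ, zero_mul,
      zero_add]
    calc _ = ε * ∑ k, m k * V k i := by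
          rw [Finset.mul_sum]
          exact Finset.sum_congr rfl fun k _ => by ring
      _ = ε := by rw [hm, mul_one]
  -- This n makes the new row i vanish on x. The rows other than i and j vanish on it as well, so N
  -- x = A_j e_j, and unimodularity of N makes x divisible by A_j.
  set n := ∑ k, m k * V k j with hn
  set x : Fin (d + 1) → ℤ := fun k => borderTop (g : ℤ) V k j - n * borderTop (g : ℤ) V k i with hx
  have hNx : N.mulVec x = fun l => if l = j then A j else 0 := by
    ext l
    by_cases hl : l = i
    · subst hl
      rw [if_neg hij]
      have : N l = Fin.cons 0 m := by rw [hN, Matrix.updateRow_self]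
      rw [Matrix.mulVec, this, dotProduct, Fin.sum_univ_succ]
      simp only [Fin.cons_zero, Fin.cons_succ, zero_mul, hx, borderTop_succ, mul_sub,
        Finset.sum_sub_distrib]
      have : ∑ k, m k * (n * V k l) = n * ∑ k, m k * V k l := by
        rw [Finset.mul_sum]
        exact Finset.sum_congr rfl fun k _ => by ring
      rw [this, hm, ← hn]
      ring
    · have h1 : N l = borderLeft 1 U l := by rw [hN, Matrix.updateRow_ne hl]
      have h2 : ∀ c, ∑ k, borderLeft 1 U l k * borderTop (g : ℤ) V k c = if l = c then A l else 0 := by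
        intro c
        have := congrFun (congrFun h.border_mul' l) c
        rw [Matrix.mul_apply, Matrix.diagonal_apply] at this
        exact this
      rw [Matrix.mulVec, h1, dotProduct]
      simp only [hx, mul_sub, Finset.sum_sub_distrib]
      have : ∑ k, borderLeft 1 U l k * (n * borderTop (g : ℤ) V k i) =
          n * ∑ k, borderLeft 1 U l k * borderTop (g : ℤ) V k i := by
        rw [Finset.mul_sum]
        exact Finset.sum_congr rfl fun k _ => by ring
      rw [this, h2, h2, if_neg hl, mul_zero, sub_zero]
      split_ifs with h3
      · rw [h3]
      · rfl
  have hxdvd : ∀ k, A j ∣ x k := by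
    intro k
    have h1 := congrArg (fun y => N.adjugate.mulVec y) hNx
    simp only [Matrix.mulVec_mulVec, Matrix.adjugate_mul, hNdet, Matrix.smul_mulVec,
      Matrix.one_mulVec] at h1
    have h2 := congrFun h1 k
    rw [Pi.smul_apply, smul_eq_mul] at h2
    have h3 : x k = ε * (ε * x k) := by rw [← mul_assoc, hε, one_mul]
    rw [h3, h2]
    refine Dvd.dvd.mul_left ?_ _
    simp [Matrix.mulVec, dotProduct]
  exact ⟨n, hxdvd 0, fun k => hxdvd k.succ⟩

end Integral

/-! ### The extremal simplices -/

/-- The product of the first `n` terms of the Sylvester sequence. -/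
def sylvesterProd (g n : ℕ) : ℤ := ∏ l ∈ Finset.range n, sylvester g (l + 1)

/-- The product of the first `n` terms of the Sylvester sequence without the one in position `k`. -/
def sylvesterCoprod (g n k : ℕ) : ℤ := ∏ l ∈ (Finset.range n).erase k, sylvester g (l + 1)

theorem sylvester_mul_coprod (g : ℕ) {n k : ℕ} (hk : k < n) :
    sylvester g (k + 1) * sylvesterCoprod g n k = sylvesterProd g n :=
  Finset.mul_prod_erase _ (fun l => sylvester g (l + 1)) (Finset.mem_range.2 hk)

theorem truncSylvester_eq_mul_sylvesterProd (g n : ℕ) :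
    truncSylvester g (n + 1) = g * sylvesterProd g n := truncSylvester_eq_prod g n

theorem sylvesterProd_pos {g : ℕ} (hg : 1 ≤ g) (n : ℕ) : 0 < sylvesterProd g n :=
  Finset.prod_pos fun l _ => (by norm_num : (0 : ℤ) < 2).trans_le (sylvester_pos hg l)

/-- The identity ∑ 1/s_{g,k} = 1/g - 1/t_{g,n+1} with denominators cleared. -/
theorem sum_sylvesterCoprod {g : ℕ} (hg : 1 ≤ g) (n : ℕ) :
    g * ∑ k : Fin n, sylvesterCoprod g n k = sylvesterProd g n - 1 := by
  have hS : ∀ i, (sylvester g (i + 1) : ℝ) ≠ 0 := fun i => by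
    have := sylvester_pos hg i
    exact_mod_cast (by omega : sylvester g (i + 1) ≠ 0)
  have hg' : (g : ℝ) ≠ 0 := by
    have : g ≠ 0 := by omega
    exact_mod_cast this
  have hp : (sylvesterProd g n : ℝ) ≠ 0 := by exact_mod_cast (sylvesterProd_pos hg n).ne'
  have h := sum_one_div_sylvester hg n
  rw [truncSylvester_eq_mul_sylvesterProd] at h
  have hq : ∀ k ∈ Finset.range n, (1 : ℝ) / sylvester g (k + 1) =
      sylvesterCoprod g n k / sylvesterProd g n := by
    intro k hk
    rw [← sylvester_mul_coprod g (Finset.mem_range.1 hk)] at hp ⊢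
    push_cast at hp ⊢
    have := right_ne_zero_of_mul hp
    have := hS k
    field_simp
  rw [Finset.sum_congr rfl hq, ← Finset.sum_div] at h
  rw [Fin.sum_univ_eq_sum_range (fun k => sylvesterCoprod g n k) n]
  push_cast at h
  field_simp at h
  have h' : (g : ℝ) * ∑ k ∈ Finset.range n, (sylvesterCoprod g n k : ℝ) =
      sylvesterProd g n - 1 := by linarith
  exact_mod_cast h'

/-- The general extremal matrix over the integers, in dimension `e + 2`. -/
def extremalIntMatrix (e g : ℕ) : Matrix (Fin (e + 2)) (Fin (e + 3)) ℤ :=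
  Matrix.of fun i j =>
    if (j : ℕ) + 1 < e + 2 then (if (i : ℕ) = (j : ℕ) then 1 else 0)
    else if (j : ℕ) + 1 = e + 2 then
      (if (i : ℕ) + 1 = e + 2 then sylvesterProd g (e + 1)
        else sylvesterProd g (e + 1) - g * sylvesterCoprod g (e + 1) i)
    else
      (if (i : ℕ) + 1 = e + 2 then -sylvesterProd g (e + 1)
        else -(sylvesterProd g (e + 1) + g * sylvesterCoprod g (e + 1) i))

/-- The vertices of the `g`-fold of the dual of the general extremal simplex. -/
def extremalDualMatrix (e g : ℕ) : Matrix (Fin (e + 3)) (Fin (e + 2)) ℤ :=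
  Matrix.of fun i k =>
    if (k : ℕ) + 1 < e + 2 then (if (i : ℕ) = (k : ℕ) then sylvester g (k + 1) else 0) - g
    else g * (e + 1) +
      if (i : ℕ) + 1 < e + 2 then -sylvester g (i + 1)
      else if (i : ℕ) + 1 = e + 2 then (g : ℤ) else -g

/-- The unit fraction partition of the general extremal simplex. -/
def extremalPartition (e g : ℕ) : Fin (e + 3) → ℤ := fun i =>
  if (i : ℕ) + 1 < e + 2 then sylvester g (i + 1) else 2 * g * sylvesterProd g (e + 1)

section Entries

variable (e g : ℕ)

@[simp] theorem extremalIntMatrix_castSucc_castSucc (i : Fin (e + 2)) (j : Fin (e + 1)) :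
    extremalIntMatrix e g i j.castSucc.castSucc = if i = j.castSucc then 1 else 0 := by
  have := Nat.le_of_lt_succ j.isLt
  simp [extremalIntMatrix, Fin.ext_iff, this]

@[simp] theorem extremalIntMatrix_castSucc_last (i : Fin (e + 1)) :
    extremalIntMatrix e g i.castSucc (Fin.last (e + 1)).castSucc =
      sylvesterProd g (e + 1) - g * sylvesterCoprod g (e + 1) i := by
  have := i.isLt
  simp [extremalIntMatrix, this.ne]

@[simp] theorem extremalIntMatrix_last_last :
    extremalIntMatrix e g (Fin.last (e + 1)) (Fin.last (e + 1)).castSucc =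
      sylvesterProd g (e + 1) := by
  simp [extremalIntMatrix]

@[simp] theorem extremalIntMatrix_castSucc_last' (i : Fin (e + 1)) :
    extremalIntMatrix e g i.castSucc (Fin.last (e + 2)) =
      -(sylvesterProd g (e + 1) + g * sylvesterCoprod g (e + 1) i) := by
  have := i.isLt
  simp [extremalIntMatrix, this.ne]

@[simp] theorem extremalIntMatrix_last_last' :
    extremalIntMatrix e g (Fin.last (e + 1)) (Fin.last (e + 2)) = -sylvesterProd g (e + 1) := by
  simp [extremalIntMatrix]

@[simp] theorem extremalDualMatrix_castSucc (i : Fin (e + 3)) (k : Fin (e + 1)) :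
    extremalDualMatrix e g i k.castSucc =
      (if i = k.castSucc.castSucc then sylvester g (k + 1) else 0) - g := by
  have := Nat.le_of_lt_succ k.isLt
  simp [extremalDualMatrix, Fin.ext_iff, this]

@[simp] theorem extremalDualMatrix_castSucc_last (i : Fin (e + 1)) :
    extremalDualMatrix e g i.castSucc.castSucc (Fin.last (e + 1)) =
      g * (e + 1) - sylvester g (i + 1) := by
  have := Nat.le_of_lt_succ i.isLt
  simp [extremalDualMatrix, this, sub_eq_add_neg]

@[simp] theorem extremalDualMatrix_last_castSucc_last :
    extremalDualMatrix e g (Fin.last (e + 1)).castSucc (Fin.last (e + 1)) = g * (e + 2) := by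
  simp [extremalDualMatrix]
  ring

@[simp] theorem extremalDualMatrix_last_last :
    extremalDualMatrix e g (Fin.last (e + 2)) (Fin.last (e + 1)) = g * e := by
  simp [extremalDualMatrix]
  ring

@[simp] theorem extremalPartition_castSucc (i : Fin (e + 1)) :
    extremalPartition e g i.castSucc.castSucc = sylvester g (i + 1) := by
  have := Nat.le_of_lt_succ i.isLt
  simp [extremalPartition, this]

@[simp] theorem extremalPartition_last_castSucc :
    extremalPartition e g (Fin.last (e + 1)).castSucc = 2 * g * sylvesterProd g (e + 1) := by
  simp [extremalPartition]

@[simp] theorem extremalPartition_last :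
    extremalPartition e g (Fin.last (e + 2)) = 2 * g * sylvesterProd g (e + 1) := by
  simp [extremalPartition]

end Entries

theorem extremalMatrix_eq {g : ℕ} (hg : 1 ≤ g) (e : ℕ) :
    extremalMatrix (e + 2) g = toRealMatrix (extremalIntMatrix e g) := by
  have hg' : (g : ℝ) ≠ 0 := by
    have : g ≠ 0 := by omega
    exact_mod_cast this
  have ht : (truncSylvester g (e + 2) : ℝ) / g = sylvesterProd g (e + 1) := by
    rw [truncSylvester_eq_mul_sylvesterProd]
    push_cast
    field_simp
  have hS : ∀ i, (sylvester g (i + 1) : ℝ) ≠ 0 := fun i => by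
    have := sylvester_pos hg i
    exact_mod_cast (by omega : sylvester g (i + 1) ≠ 0)
  have hq : ∀ i : Fin (e + 2), (i : ℕ) + 1 ≠ e + 2 → (sylvesterProd g (e + 1) : ℝ) =
      sylvester g (i + 1) * sylvesterCoprod g (e + 1) i := by
    intro i hi
    rw [← sylvester_mul_coprod g (k := i) (by omega)]
    push_cast
    ring
  ext i j
  simp only [extremalMatrix, extremalIntMatrix, toRealMatrix_apply, Matrix.of_apply, ht]
  have hSi := hS i
  split_ifs with h1 h2 h3 h4 h5
  · simp
  · simp
  · simp
  · push_cast
    rw [hq i h4]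
    field_simp
  · simp
  · push_cast
    rw [hq i h5]
    field_simp

theorem extremal_isDualPair {g : ℕ} (hg : 1 ≤ g) (e : ℕ) :
    IsDualPair (extremalIntMatrix e g) (extremalDualMatrix e g) (extremalPartition e g) (g : ℤ) := by
  have hq := sum_sylvesterCoprod hg (e + 1)
  have hm : ∀ i : Fin (e + 1), sylvester g (i + 1) * sylvesterCoprod g (e + 1) i =
      sylvesterProd g (e + 1) := fun i => sylvester_mul_coprod g i.isLt
  have hsum : ∀ (i : Fin (e + 3)) (f : Fin (e + 1) → ℤ),
      ∑ k, extremalDualMatrix e g i k.castSucc * f k =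
        (∑ k : Fin (e + 1), if i = k.castSucc.castSucc then sylvester g (k + 1) * f k else 0) -
          g * ∑ k, f k := by
    intro i f
    simp only [extremalDualMatrix_castSucc, sub_mul, Finset.sum_sub_distrib, Finset.mul_sum,
      ite_mul, zero_mul]
  have hv : ∑ k : Fin (e + 1), (sylvesterProd g (e + 1) - g * sylvesterCoprod g (e + 1) k) =
      (e + 1) * sylvesterProd g (e + 1) - (sylvesterProd g (e + 1) - 1) := by
    rw [Finset.sum_sub_distrib, ← Finset.mul_sum, hq]
    simp
  have hw : ∑ k : Fin (e + 1), -(sylvesterProd g (e + 1) + g * sylvesterCoprod g (e + 1) k) =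
      -((e + 1) * sylvesterProd g (e + 1) + (sylvesterProd g (e + 1) - 1)) := by
    rw [Finset.sum_neg_distrib, Finset.sum_add_distrib, ← Finset.mul_sum, hq]
    simp
  have hne1 : ∀ k : Fin (e + 1), Fin.last (e + 2) ≠ k.castSucc.castSucc := fun k =>
    (Fin.castSucc_lt_last _).ne'
  have hne2 : ∀ k : Fin (e + 1), (Fin.last (e + 1)).castSucc ≠ k.castSucc.castSucc := fun k h =>
    (Fin.castSucc_lt_last k).ne' (Fin.castSucc_injective _ h)
  have hne3 : Fin.last (e + 2) ≠ (Fin.last (e + 1)).castSucc := (Fin.castSucc_lt_last _).ne'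
  ext i j
  rw [Matrix.mul_apply, Matrix.sub_apply, Matrix.diagonal_apply, Matrix.of_apply,
    Fin.sum_univ_castSucc, hsum]
  refine Fin.lastCases ?_ (fun j => Fin.lastCases ?_ (fun j => ?_) j) j
  · simp only [extremalIntMatrix_castSucc_last', extremalIntMatrix_last_last', hw]
    refine Fin.lastCases ?_ (fun i => Fin.lastCases ?_ (fun i => ?_) i) i
    · simp only [hne1, if_false, Finset.sum_const_zero, extremalDualMatrix_last_last, if_true,
        extremalPartition_last]
      ring
    · simp only [hne2, hne3.symm, if_false, Finset.sum_const_zero,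
        extremalDualMatrix_last_castSucc_last]
      ring
    · simp only [Fin.castSucc_inj, (hne1 i).symm, if_false, Finset.sum_ite_eq, Finset.mem_univ,
        if_true, extremalDualMatrix_castSucc_last]
      linear_combination (-(g : ℤ)) * hm i
  · simp only [extremalIntMatrix_castSucc_last, extremalIntMatrix_last_last, hv]
    refine Fin.lastCases ?_ (fun i => Fin.lastCases ?_ (fun i => ?_) i) i
    · simp only [hne1, hne3, if_false, Finset.sum_const_zero, extremalDualMatrix_last_last]
      ring
    · simp only [hne2, if_false, if_true, Finset.sum_const_zero,
        extremalDualMatrix_last_castSucc_last, extremalPartition_last_castSucc]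
      ring
    · simp only [Fin.castSucc_inj, (hne2 i).symm, if_false,
        Finset.sum_ite_eq, Finset.mem_univ, if_true, extremalDualMatrix_castSucc_last]
      linear_combination (-(g : ℤ)) * hm i
  · have hlast : Fin.last (e + 1) ≠ j.castSucc := (Fin.castSucc_lt_last j).ne'
    simp only [extremalIntMatrix_castSucc_castSucc, Fin.castSucc_inj, hlast, if_false, mul_zero,
      add_zero, mul_ite, mul_one, Finset.sum_ite_eq', Finset.mem_univ, if_true]
    congr 1
    by_cases hij : i = j.castSucc.castSucc
    · subst hij
      simp [Fin.castSucc_inj]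
    · rw [if_neg hij]
      refine Finset.sum_eq_zero fun k _ => ?_
      split_ifs with h1 h2
      · exact absurd (h2 ▸ h1) hij
      · rfl
      · rfl

/-- One entry of the adjugate form of `border_mul`. It reduces the volume to the minor without the
last column, which is triangular for the extremal matrices. -/
theorem IsDualPair.abs_det_mul {d : ℕ} {V : Matrix (Fin d) (Fin (d + 1)) ℤ}
    {U : Matrix (Fin (d + 1)) (Fin d) ℤ} {A : Fin (d + 1) → ℤ} {g : ℤ} (h : IsDualPair V U A g) :
    |(borderTop 1 V).det| * |g| =
      |A (Fin.last d)| * |(V.submatrix id Fin.castSucc).det| := by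
  have h1 := congrArg (fun M => M * (borderTop 1 V).adjugate) h.border_mul
  simp only [Matrix.mul_assoc, Matrix.mul_adjugate, Matrix.mul_smul, Matrix.mul_one] at h1
  have h2 := congrFun (congrFun h1 (Fin.last d)) 0
  rw [Matrix.smul_apply, borderLeft_zero, Matrix.diagonal_mul,
    Matrix.adjugate_fin_succ_eq_det_submatrix, smul_eq_mul] at h2
  rw [← abs_mul, h2, abs_mul, abs_mul, abs_pow]
  simp only [abs_neg, abs_one, one_pow, one_mul]
  congr 3
  ext i j
  simp

theorem abs_det_borderTop_extremal {g : ℕ} (hg : 1 ≤ g) (e : ℕ) :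
    |(borderTop 1 (extremalIntMatrix e g)).det| = 2 * sylvesterProd g (e + 1) ^ 2 := by
  have h := (extremal_isDualPair hg e).abs_det_mul
  have hdet : ((extremalIntMatrix e g).submatrix id Fin.castSucc).det = sylvesterProd g (e + 1) := by
    rw [Matrix.det_of_isUpperTriangular]
    · rw [Fin.prod_univ_castSucc]
      simp
    · intro i j hij
      refine Fin.lastCases (fun hij => ?_) (fun j hij => ?_) j hij
      · exact absurd hij (not_lt.2 (Fin.le_last i))
      · have : i ≠ j.castSucc := (ne_of_lt hij).symm
        simp [this]
  have hp := sylvesterProd_pos hg (e + 1)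
  have hg' : (0 : ℤ) < g := by exact_mod_cast hg
  rw [hdet, extremalPartition_last, abs_of_pos hp, abs_of_pos hg',
    abs_of_pos (a := 2 * (g : ℤ) * sylvesterProd g (e + 1)) (by positivity)] at h
  refine mul_right_cancel₀ hg'.ne' ?_
  rw [h]
  ring

/-- A common divisor of one of the last two columns divides π = s_{g,1} ⋯ s_{g,e+1} and all g π /
s_{g,k}. The sum of the latter is π - 1, so it divides 1. -/
theorem extremal_primitive {g : ℕ} (hg : 1 ≤ g) (e : ℕ) (j : Fin (e + 3)) :
    IsPrimitivePoint fun i => extremalIntMatrix e g i j := by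
  have hq := sum_sylvesterCoprod hg (e + 1)
  have key : ∀ k : ℤ, k ∣ sylvesterProd g (e + 1) →
      (∀ i : Fin (e + 1), k ∣ g * sylvesterCoprod g (e + 1) i) → IsUnit k := by
    intro k h1 h2
    refine isUnit_of_dvd_one ?_
    have h3 : k ∣ g * ∑ i : Fin (e + 1), sylvesterCoprod g (e + 1) i := by
      rw [Finset.mul_sum]
      exact Finset.dvd_sum fun i _ => h2 i
    rw [hq] at h3
    simpa using dvd_sub h1 h3
  refine Fin.lastCases ?_ (fun j => Fin.lastCases ?_ (fun j => ?_) j) j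
  · intro k w h
    have h1 : k ∣ sylvesterProd g (e + 1) := by
      have := congrFun h (Fin.last (e + 1))
      simp only [extremalIntMatrix_last_last', Pi.smul_apply, smul_eq_mul] at this
      exact (dvd_neg (a := k)).1 ⟨_, this⟩
    refine key k h1 fun i => ?_
    have := congrFun h i.castSucc
    simp only [extremalIntMatrix_castSucc_last', Pi.smul_apply, smul_eq_mul] at this
    exact (dvd_add_right h1).1 ((dvd_neg (a := k)).1 ⟨_, this⟩)
  · intro k w h
    have h1 : k ∣ sylvesterProd g (e + 1) := by
      have := congrFun h (Fin.last (e + 1))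
      simp only [extremalIntMatrix_last_last, Pi.smul_apply, smul_eq_mul] at this
      exact ⟨_, this⟩
    refine key k h1 fun i => ?_
    have := congrFun h i.castSucc
    simp only [extremalIntMatrix_castSucc_last, Pi.smul_apply, smul_eq_mul] at this
    exact (dvd_sub_right h1).1 ⟨_, this⟩
  · intro k w h
    have := congrFun h j.castSucc
    simp only [extremalIntMatrix_castSucc_castSucc, if_true, Pi.smul_apply, smul_eq_mul] at this
    exact IsUnit.of_mul_eq_one _ this.symm

theorem extremalPartition_pos {g : ℕ} (hg : 1 ≤ g) (e : ℕ) (j : Fin (e + 3)) :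
    0 < extremalPartition e g j := by
  have hp := sylvesterProd_pos hg (e + 1)
  have hg' : (0 : ℤ) < g := by exact_mod_cast hg
  rw [extremalPartition]
  split_ifs
  · linarith [sylvester_pos hg j]
  · positivity

theorem extremal_isFanoSimplex {g : ℕ} (hg : 1 ≤ g) (e : ℕ) :
    IsFanoSimplex (simplexOf (extremalMatrix (e + 2) g)) := by
  rw [extremalMatrix_eq hg]
  exact (extremal_isDualPair hg e).isFanoSimplex (extremalPartition_pos hg e) hg
    (extremal_primitive hg e)

theorem extremal_gorensteinIndex {g : ℕ} (hg : 1 ≤ g) (e : ℕ) :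
    gorensteinIndex (simplexOf (extremalMatrix (e + 2) g)) = g := by
  rw [extremalMatrix_eq hg]
  -- The chosen entry is s_{g,1} - g = 1, coprime to g.
  refine (extremal_isDualPair hg e).gorensteinIndex_eq (extremalPartition_pos hg e) hg
    (i := (0 : Fin (e + 1)).castSucc.castSucc) (l := (0 : Fin (e + 1)).castSucc) ?_
  rw [extremalDualMatrix_castSucc, if_pos rfl]
  simp [sylvester, isCoprime_one_right]

/-- The extremal triangle over the integers. -/
def extremalIntTriangle : Matrix (Fin 2) (Fin 3) ℤ := !![1, 1, -2; 0, 3, -3]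

/-- The sporadic extremal tetrahedron over the integers. -/
def extremalIntTetrahedron : Matrix (Fin 3) (Fin 4) ℤ := !![1, 1, 1, -5; 0, 2, 2, -4; 0, 0, 6, -6]

theorem extremalTriangle_eq : extremalTriangle = toRealMatrix extremalIntTriangle := by
  ext i j
  fin_cases i <;> fin_cases j <;> simp [extremalTriangle, extremalIntTriangle]

theorem extremalTetrahedron_eq : extremalTetrahedron = toRealMatrix extremalIntTetrahedron := by
  ext i j
  fin_cases i <;> fin_cases j <;> simp [extremalTetrahedron, extremalIntTetrahedron]

theorem triangle_isDualPair :
    IsDualPair extremalIntTriangle !![2, -1; -1, 1; -1, 0] (fun _ => 3) ((1 : ℕ) : ℤ) := by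
  unfold IsDualPair extremalIntTriangle
  decide

theorem tetrahedron_isDualPair :
    IsDualPair extremalIntTetrahedron !![1, -1, 0; -1, 3, -1; -1, 0, 1; -1, 0, 0] ![2, 6, 6, 6]
      ((1 : ℕ) : ℤ) := by
  unfold IsDualPair extremalIntTetrahedron
  decide

theorem triangle_primitive (j : Fin 3) : IsPrimitivePoint fun i => extremalIntTriangle i j := by
  intro k w h
  have h0 := congrFun h 0
  have h1 := congrFun h 1
  refine isUnit_of_dvd_one ?_
  simp only [Pi.smul_apply, smul_eq_mul] at h0 h1
  fin_cases j
  · exact ⟨w 0, by simpa [extremalIntTriangle] using h0⟩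
  · exact ⟨w 0, by simpa [extremalIntTriangle] using h0⟩
  · refine ⟨w 0 - w 1, ?_⟩
    simp [extremalIntTriangle] at h0 h1
    linarith

theorem tetrahedron_primitive (j : Fin 4) :
    IsPrimitivePoint fun i => extremalIntTetrahedron i j := by
  intro k w h
  have h0 := congrFun h 0
  have h1 := congrFun h 1
  refine isUnit_of_dvd_one ?_
  simp only [Pi.smul_apply, smul_eq_mul] at h0 h1
  fin_cases j
  · exact ⟨w 0, by simpa [extremalIntTetrahedron] using h0⟩
  · exact ⟨w 0, by simpa [extremalIntTetrahedron] using h0⟩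
  · exact ⟨w 0, by simpa [extremalIntTetrahedron] using h0⟩
  · refine ⟨w 1 - w 0, ?_⟩
    simp [extremalIntTetrahedron] at h0 h1
    linarith

theorem abs_det_borderTop_triangle : |(borderTop 1 extremalIntTriangle).det| = 9 := by
  have h := triangle_isDualPair.abs_det_mul
  have hdet : (extremalIntTriangle.submatrix id Fin.castSucc).det = 3 := by
    simp [extremalIntTriangle, Matrix.det_fin_two]
  rw [hdet] at h
  simpa using h

theorem abs_det_borderTop_tetrahedron : |(borderTop 1 extremalIntTetrahedron).det| = 72 := by
  have h := tetrahedron_isDualPair.abs_det_mul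
  have hdet : (extremalIntTetrahedron.submatrix id Fin.castSucc).det = 12 := by
    decide
  rw [hdet] at h
  simpa [Fin.last] using h

/-! ### Lattice isomorphisms -/

theorem image_simplexOf {d : ℕ} (M : Matrix (Fin d) (Fin d) ℤ) (V : Matrix (Fin d) (Fin (d + 1)) ℤ) :
    (fun x : Fin d → ℝ => (toRealMatrix M).mulVec x) '' simplexOf (toRealMatrix V) =
      simplexOf (toRealMatrix (M * V)) := by
  rw [simplexOf_eq_image, simplexOf_eq_image, Set.image_image, toRealMatrix_mul]
  simp [Matrix.mulVec_mulVec]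

theorem LatticeIso.dim_eq {d e : ℕ} {S : Set (Fin d → ℝ)} {T : Set (Fin e → ℝ)}
    (h : LatticeIso S T) : d = e := by
  obtain ⟨φ, -⟩ := h
  simpa using φ.finrank_eq

theorem latticeIso_of_eq_mul {d : ℕ} {M M' : Matrix (Fin d) (Fin d) ℤ}
    {V : Matrix (Fin d) (Fin (d + 1)) ℤ} (h : M * M' = 1) :
    LatticeIso (simplexOf (toRealMatrix V)) (simplexOf (toRealMatrix (M * V))) := by
  refine ⟨Matrix.toLin'OfInv (mul_eq_one_comm.1 h) h, ?_⟩
  have : LinearMap.toMatrix' ((Matrix.toLin'OfInv (mul_eq_one_comm.1 h) h :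
      (Fin d → ℤ) ≃ₗ[ℤ] (Fin d → ℤ)) : (Fin d → ℤ) →ₗ[ℤ] (Fin d → ℤ)) = M :=
    LinearMap.toMatrix'_toLin' M
  rw [this, image_simplexOf]

theorem LatticeIso.exists_eq_mul {d : ℕ} {S : Set (Fin d → ℝ)}
    {P : Matrix (Fin d) (Fin (d + 1)) ℤ} (h : LatticeIso S (simplexOf (toRealMatrix P))) :
    ∃ M M' : Matrix (Fin d) (Fin d) ℤ, M * M' = 1 ∧ S = simplexOf (toRealMatrix (M * P)) := by
  obtain ⟨φ, hφ⟩ := h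
  set N := LinearMap.toMatrix' (φ : (Fin d → ℤ) →ₗ[ℤ] (Fin d → ℤ)) with hN
  set N' := LinearMap.toMatrix' (φ.symm : (Fin d → ℤ) →ₗ[ℤ] (Fin d → ℤ)) with hN'
  have h1 : N' * N = 1 := by
    rw [hN, hN', ← LinearMap.toMatrix'_comp]
    simp
  refine ⟨N', N, h1, ?_⟩
  rw [← image_simplexOf, ← hφ, Set.image_image]
  simp only [Matrix.mulVec_mulVec, ← toRealMatrix_mul, h1]
  have : toRealMatrix (1 : Matrix (Fin d) (Fin d) ℤ) = 1 :=
    Matrix.map_one _ (by simp) (by simp)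
  simp [this]

theorem det_borderTop_mul {d : ℕ} (M : Matrix (Fin d) (Fin d) ℤ)
    (V : Matrix (Fin d) (Fin (d + 1)) ℤ) :
    (borderTop 1 (M * V)).det = M.det * (borderTop 1 V).det := by
  rw [det_borderTop, det_borderTop, ← Matrix.det_mul]
  congr 1
  ext i j
  simp [Matrix.mul_apply, mul_sub]

theorem LatticeIso.normalizedVolume_eq {d : ℕ} {S : Set (Fin d → ℝ)}
    {P : Matrix (Fin d) (Fin (d + 1)) ℤ} (h : LatticeIso S (simplexOf (toRealMatrix P))) :
    normalizedVolume S = (|(borderTop 1 P).det| : ℤ) := by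
  obtain ⟨M, M', hM, rfl⟩ := h.exists_eq_mul
  rw [normalizedVolume_toRealMatrix, det_borderTop_mul, abs_mul]
  have : IsUnit M.det := (Matrix.isUnit_iff_isUnit_det _).1 (IsUnit.of_mul_eq_one M' hM)
  rw [Int.isUnit_iff_abs_eq.1 this, one_mul]

/-- The dual pair (P, U) transforms into (M P, U M⁻¹) with the same A. This shows that the
tetrahedron can only occur for g = 1. -/
theorem LatticeIso.gorensteinIndex_eq_one {d : ℕ} {S : Set (Fin d → ℝ)} (hd : 1 ≤ d)
    {P : Matrix (Fin d) (Fin (d + 1)) ℤ} {U : Matrix (Fin (d + 1)) (Fin d) ℤ}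
    {A : Fin (d + 1) → ℤ} (hP : IsDualPair P U A ((1 : ℕ) : ℤ)) (hA : ∀ j, 0 < A j)
    (h : LatticeIso S (simplexOf (toRealMatrix P))) : gorensteinIndex S = 1 := by
  obtain ⟨M, M', hM, rfl⟩ := h.exists_eq_mul
  have hpair : IsDualPair (M * P) (U * M') A ((1 : ℕ) : ℤ) := by
    rw [IsDualPair, Matrix.mul_assoc, ← Matrix.mul_assoc M', mul_eq_one_comm.1 hM, Matrix.one_mul]
    exact hP
  exact hpair.gorensteinIndex_eq hA le_rfl (i := 0) (l := ⟨0, hd⟩) (by simp [isCoprime_one_left])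

/-- Volumes scale by |det B|, so equal nonzero volumes make B unimodular. -/
theorem latticeIso_of_eq_mul_of_abs_det_eq {d : ℕ} {B : Matrix (Fin d) (Fin d) ℤ}
    {V P : Matrix (Fin d) (Fin (d + 1)) ℤ} (hV : V = B * P)
    (hdet : |(borderTop 1 V).det| = |(borderTop 1 P).det|) (hP : (borderTop 1 P).det ≠ 0) :
    LatticeIso (simplexOf (toRealMatrix V)) (simplexOf (toRealMatrix P)) := by
  have hB : IsUnit B.det := by
    rw [hV, det_borderTop_mul, abs_mul] at hdet
    rw [Int.isUnit_iff_abs_eq]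
    refine mul_right_cancel₀ (abs_ne_zero.2 hP) ?_
    rw [hdet, one_mul]
  have hP' : P = B⁻¹ * V := by
    rw [hV, ← Matrix.mul_assoc, Matrix.nonsing_inv_mul _ hB, Matrix.one_mul]
  rw [hP']
  exact latticeIso_of_eq_mul (Matrix.nonsing_inv_mul _ hB)

/-! ### The volume bound -/

section Bound

variable {d g : ℕ} {V : Matrix (Fin d) (Fin (d + 1)) ℤ} {U : Matrix (Fin (d + 1)) (Fin d) ℤ}
  {A : Fin (d + 1) → ℤ}

theorem IsFanoSimplex.exists_sorted_isDualPair {S : Set (Fin d → ℝ)} (hS : IsFanoSimplex S)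
    (hg : 1 ≤ g) (hgor : gorensteinIndex S = g) :
    ∃ (V : Matrix (Fin d) (Fin (d + 1)) ℤ) (U : Matrix (Fin (d + 1)) (Fin d) ℤ)
      (A : Fin (d + 1) → ℤ), (∀ j, 0 < A j) ∧ Monotone A ∧
      (∀ j, IsPrimitivePoint fun i => V i j) ∧
      IsDualPair V U A g ∧ S = simplexOf (toRealMatrix V) := by
  obtain ⟨V, U, A, hA, hV, h, rfl⟩ := hS.exists_isDualPair hg hgor
  refine ⟨V.submatrix id (Tuple.sort A), U.submatrix (Tuple.sort A) id, A ∘ Tuple.sort A,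
    fun j => hA _, Tuple.monotone_sort A, fun j => hV _, h.submatrix _, ?_⟩
  exact (simplexOf_submatrix _ (Tuple.sort A)).symm

theorem IsDualPair.mul_abs_det_mul_abs_det (h : IsDualPair V U A (g : ℤ)) (hA : ∀ j, 0 < A j) :
    g * |(borderTop 1 V).det| * |(borderLeft 1 U).det| =
      (∏ j : Fin d, A j.castSucc) * A (Fin.last d) := by
  have h1 : |∏ j, A j| = ∏ j, A j := abs_of_nonneg (Finset.prod_nonneg fun j _ => (hA j).le)
  rw [← Fin.prod_univ_castSucc, ← h1, ← h.det_mul_det, abs_mul, abs_mul, Nat.abs_cast]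
  ring

theorem IsDualPair.le_abs_det (h : IsDualPair V U A (g : ℤ)) (hA : ∀ j, 0 < A j)
    (hprim : ∀ j, IsPrimitivePoint fun i => V i j) (j : Fin (d + 1)) :
    A j ≤ |(borderLeft 1 U).det| := by
  refine Int.le_of_dvd (abs_pos.2 fun h0 => ?_) ((dvd_abs _ _).2 (h.dvd_det (hprim j)))
  have := h.det_mul_det
  rw [h0, mul_zero, zero_mul] at this
  exact (Finset.prod_pos fun j _ => hA j).ne this

/-- The volume is at most `c / g ^ 2` if the product of all but the last entry of the unit fraction
partition is at most `c / g`; equality forces the facet opposite the last vertex of the dual to be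
unimodular. -/
theorem IsDualPair.sq_mul_abs_det_le (h : IsDualPair V U A (g : ℤ))
    (hA : ∀ j, 0 < A j) (hprim : ∀ j, IsPrimitivePoint fun i => V i j) {c : ℤ} (hc : 0 < c)
    (hle : g * ∏ j : Fin d, A j.castSucc ≤ c) :
    g ^ 2 * |(borderTop 1 V).det| ≤ c ∧ (g ^ 2 * |(borderTop 1 V).det| = c →
      g * ∏ j : Fin d, A j.castSucc = c ∧ |(borderLeft 1 U).det| = A (Fin.last d)) := by
  have h1 := h.mul_abs_det_mul_abs_det hA
  have h2 := h.le_abs_det hA hprim (Fin.last d)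
  have h3 := hA (Fin.last d)
  set W := |(borderTop 1 V).det|
  set D := |(borderLeft 1 U).det|
  set p := ∏ j : Fin d, A j.castSucc
  have hD : 0 < D := h3.trans_le h2
  -- The bound is the chain g² W D = g p A_d ≤ c A_d ≤ c D, using the product bound and then A_d ≤
  -- D. Equality at the ends makes both steps equalities.
  have h4 : g ^ 2 * W * D = (g * p) * A (Fin.last d) := by linear_combination (g : ℤ) * h1
  have h5 : (g * p) * A (Fin.last d) ≤ c * A (Fin.last d) := by gcongr
  have h6 : c * A (Fin.last d) ≤ c * D := by gcongr
  refine ⟨le_of_mul_le_mul_right (h4.le.trans (h5.trans h6)) hD, fun heq => ?_⟩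
  rw [heq] at h4
  have h7 : D = A (Fin.last d) :=
    le_antisymm (le_of_mul_le_mul_left (h4.le.trans h5) hc) h2
  refine ⟨?_, h7⟩
  rw [h7] at h4
  exact (mul_right_cancel₀ h3.ne' h4).symm

/-- The entries of a unit fraction partition as a sequence. -/
def extendFin (A : Fin (d + 1) → ℤ) (i : ℕ) : ℤ := A ⟨min i d, by omega⟩

theorem extendFin_val (A : Fin (d + 1) → ℤ) (i : Fin (d + 1)) : extendFin A i = A i := by
  rw [extendFin]
  congr 1
  ext
  exact min_eq_left (Nat.le_of_lt_succ i.isLt)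

theorem extendFin_mono (hA : Monotone A) (i j : ℕ) (hij : i ≤ j) : extendFin A i ≤ extendFin A j :=
  hA (by rw [Fin.mk_le_mk]; omega)

theorem prod_extendFin (A : Fin (d + 1) → ℤ) :
    ∏ k ∈ Finset.range d, extendFin A k = ∏ j : Fin d, A j.castSucc := by
  rw [← Fin.prod_univ_eq_prod_range]
  exact Finset.prod_congr rfl fun j _ => extendFin_val A j.castSucc

theorem sum_extendFin (A : Fin (d + 1) → ℤ) :
    ∑ k ∈ Finset.range (d + 1), 1 / (extendFin A k : ℝ) = ∑ j, 1 / (A j : ℝ) := by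
  rw [← Fin.sum_univ_eq_sum_range (fun k => 1 / (extendFin A k : ℝ))]
  exact Finset.sum_congr rfl fun j _ => by rw [extendFin_val]

end Bound

/-! ### The equality cases -/

/-- If the facet of the dual opposite to the `i`-th vertex is unimodular and `g ∣ A j`, then the
`i`-th and `j`-th vertices agree modulo `A j / g`. -/
theorem IsDualPair.dvd_sub {d g : ℕ} {V : Matrix (Fin d) (Fin (d + 1)) ℤ}
    {U : Matrix (Fin (d + 1)) (Fin d) ℤ} {A : Fin (d + 1) → ℤ} (h : IsDualPair V U A (g : ℤ))
    (hg : 1 ≤ g) {i : Fin (d + 1)} (hAi : A i ≠ 0) (hprim : IsPrimitivePoint fun k => V k i)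
    (hdet : |(borderLeft 1 U).det| = A i) {j : Fin (d + 1)} (hij : i ≠ j) {b : ℤ}
    (hb : A j = g * b) (k : Fin d) : b ∣ V k j - V k i := by
  obtain ⟨n, hn, hV⟩ := h.exists_dvd_sub hAi hprim hdet hij
  have hg' : (g : ℤ) ≠ 0 := by
    have : g ≠ 0 := by omega
    exact_mod_cast this
  have h1 : b ∣ 1 - n := by
    rw [hb] at hn
    refine (mul_dvd_mul_iff_left hg').1 (hn.trans (dvd_of_eq (by ring)))
  have h2 : b ∣ V k j - n * V k i := (Dvd.intro_left _ hb.symm).trans (hV k)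
  have h3 : V k j - V k i = (V k j - n * V k i) - (1 - n) * V k i := by ring
  rw [h3]
  exact _root_.dvd_sub h2 (h1.mul_right _)

/-- The first e + 1 columns of the extremal matrix are standard basis vectors, which dictates the
corresponding columns of B. The last column of B is then obtained by division by π, and the point is
that this division is exact. -/
theorem IsDualPair.exists_eq_mul_extremal {e g : ℕ} (hg : 1 ≤ g)
    {V : Matrix (Fin (e + 2)) (Fin (e + 3)) ℤ} {U : Matrix (Fin (e + 3)) (Fin (e + 2)) ℤ}
    (h : IsDualPair V U (extremalPartition e g) (g : ℤ))
    (hprim : ∀ j, IsPrimitivePoint fun i => V i j)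
    (hdet : |(borderLeft 1 U).det| = extremalPartition e g (Fin.last (e + 2))) :
    ∃ B : Matrix (Fin (e + 2)) (Fin (e + 2)) ℤ, V = B * extremalIntMatrix e g := by
  have hπ := sylvesterProd_pos hg (e + 1)
  set π := sylvesterProd g (e + 1) with hπdef
  have hg' : (0 : ℝ) < g := by exact_mod_cast hg
  have hpos := extremalPartition_pos hg e
  have hpos' : ∀ j, (0 : ℝ) < extremalPartition e g j := fun j => by exact_mod_cast hpos j
  have hq : ∀ k : Fin (e + 1), sylvester g (k + 1) * sylvesterCoprod g (e + 1) k = π :=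
    fun k => sylvester_mul_coprod g k.isLt
  -- Here A_j = g · 2π, so `dvd_sub` applies with b = 2π. Half of this modulus is lost below, when
  -- the barycentric relation `hsum` is used to eliminate the last vertex.
  have hcong : ∀ l, 2 * π ∣ V l (Fin.last (e + 1)).castSucc - V l (Fin.last (e + 2)) := fun l =>
    h.dvd_sub hg (hpos _).ne' (hprim _) hdet (Fin.castSucc_lt_last _).ne'
      (by rw [extremalPartition_last_castSucc]; ring) l
  have hsum : ∀ l, V l (Fin.last (e + 1)).castSucc + V l (Fin.last (e + 2)) +
      2 * g * ∑ k : Fin (e + 1), V l k.castSucc.castSucc * sylvesterCoprod g (e + 1) k = 0 := by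
    intro l
    have h0 := h.real.sum_mul_inv hpos' hg' l
    rw [Fin.sum_univ_castSucc, Fin.sum_univ_castSucc] at h0
    simp only [toRealMatrix_apply, extremalPartition_castSucc, extremalPartition_last_castSucc,
      extremalPartition_last, ← hπdef] at h0
    have hπ' : (0 : ℝ) < π := by exact_mod_cast hπ
    have h1 : ∀ k : Fin (e + 1), (V l k.castSucc.castSucc : ℝ) / sylvester g (k + 1) =
        V l k.castSucc.castSucc * sylvesterCoprod g (e + 1) k / π := by
      intro k
      have hs : (sylvester g (k + 1) : ℝ) ≠ 0 := by
        have := sylvester_pos hg k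
        exact_mod_cast (by omega : sylvester g (k + 1) ≠ 0)
      have hq' : (sylvester g (k + 1) : ℝ) * sylvesterCoprod g (e + 1) k = π := by
        exact_mod_cast hq k
      rw [div_eq_div_iff hs hπ'.ne', ← hq']
      ring
    rw [Finset.sum_congr rfl fun k _ => h1 k, ← Finset.sum_div] at h0
    push_cast at h0
    field_simp at h0
    have h2 : (V l (Fin.last (e + 1)).castSucc : ℝ) + V l (Fin.last (e + 2)) +
      2 * g * ∑ k : Fin (e + 1), (V l k.castSucc.castSucc : ℝ) * sylvesterCoprod g (e + 1) k = 0 := by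
      linarith
    exact_mod_cast h2
  have hdvd : ∀ l, π ∣ V l (Fin.last (e + 1)).castSucc -
      ∑ k : Fin (e + 1), V l k.castSucc.castSucc * (π - g * sylvesterCoprod g (e + 1) k) := by
    intro l
    obtain ⟨z, hz⟩ := hcong l
    refine ⟨z - ∑ k : Fin (e + 1), V l k.castSucc.castSucc, ?_⟩
    have h0 := hsum l
    simp only [mul_sub, Finset.sum_sub_distrib, ← Finset.sum_mul, mul_left_comm _ (g : ℤ),
      ← Finset.mul_sum]
    linarith
  choose a ha using hdvd
  let B : Matrix (Fin (e + 2)) (Fin (e + 2)) ℤ := Matrix.of fun l =>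
    Fin.snoc (α := fun _ => ℤ) (fun k : Fin (e + 1) => V l k.castSucc.castSucc) (a l)
  have hB1 : ∀ l (k : Fin (e + 1)), B l k.castSucc = V l k.castSucc.castSucc := fun l k => by
    simp [B]
  have hB2 : ∀ l, B l (Fin.last (e + 1)) = a l := fun l => by simp [B]
  refine ⟨B, ?_⟩
  ext l j
  have h0 := hsum l
  have hal := ha l
  simp only [mul_sub, Finset.sum_sub_distrib, ← Finset.sum_mul, mul_left_comm _ (g : ℤ),
    ← Finset.mul_sum] at hal
  rw [Matrix.mul_apply, Fin.sum_univ_castSucc]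
  simp only [hB1, hB2]
  refine Fin.lastCases ?_ (fun j => Fin.lastCases ?_ (fun j => ?_) j) j
  · simp only [extremalIntMatrix_castSucc_last', extremalIntMatrix_last_last', ← hπdef, mul_neg,
      mul_add, Finset.sum_neg_distrib, Finset.sum_add_distrib, ← Finset.sum_mul,
      mul_left_comm _ (g : ℤ), ← Finset.mul_sum]
    linarith
  · simp only [extremalIntMatrix_castSucc_last, extremalIntMatrix_last_last, ← hπdef, mul_sub,
      Finset.sum_sub_distrib, ← Finset.sum_mul, mul_left_comm _ (g : ℤ), ← Finset.mul_sum]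
    linarith
  · have hlast : Fin.last (e + 1) ≠ j.castSucc := (Fin.castSucc_lt_last j).ne'
    simp [Fin.castSucc_inj, hlast]

theorem IsDualPair.sum_mul_inv_int {d g : ℕ} {V : Matrix (Fin d) (Fin (d + 1)) ℤ}
    {U : Matrix (Fin (d + 1)) (Fin d) ℤ} {A : Fin (d + 1) → ℤ} (h : IsDualPair V U A (g : ℤ))
    (hg : 1 ≤ g) (hA : ∀ j, 0 < A j) (l : Fin d) : ∑ j, (V l j : ℝ) / A j = 0 :=
  h.real.sum_mul_inv (fun j => by exact_mod_cast hA j) (by exact_mod_cast hg) l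

theorem IsDualPair.exists_eq_mul_tetrahedron {V : Matrix (Fin 3) (Fin 4) ℤ}
    {U : Matrix (Fin 4) (Fin 3) ℤ} (h : IsDualPair V U ![2, 6, 6, 6] ((1 : ℕ) : ℤ))
    (hprim : ∀ j, IsPrimitivePoint fun i => V i j) (hdet : |(borderLeft 1 U).det| = 6) :
    ∃ B : Matrix (Fin 3) (Fin 3) ℤ, V = B * extremalIntTetrahedron := by
  have hsum : ∀ l, 3 * V l 0 + V l 1 + V l 2 + V l 3 = 0 := by
    intro l
    have := h.sum_mul_inv_int le_rfl (by decide) l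
    simp [Fin.sum_univ_succ] at this
    field_simp at this
    have h2 : (3 : ℝ) * V l 0 + V l 1 + V l 2 + V l 3 = 0 := by linarith
    exact_mod_cast h2
  have h0 : ∀ l, (2 : ℤ) ∣ V l 0 - V l 3 := fun l =>
    h.dvd_sub le_rfl (i := 3) (j := 0) (by decide) (hprim 3) hdet (by decide) rfl l
  have h1 : ∀ l, (6 : ℤ) ∣ V l 1 - V l 3 := fun l =>
    h.dvd_sub le_rfl (i := 3) (j := 1) (by decide) (hprim 3) hdet (by decide) rfl l
  have h2 : ∀ l, (6 : ℤ) ∣ V l 2 - V l 3 := fun l =>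
    h.dvd_sub le_rfl (i := 3) (j := 2) (by decide) (hprim 3) hdet (by decide) rfl l
  -- The columns of B solve the triangular system given by the first three columns of the extremal
  -- matrix; the congruences make the divisions exact, and `hsum` accounts for the last column.
  refine ⟨Matrix.of fun l => ![V l 0, (V l 1 - V l 0) / 2, (V l 2 - V l 1) / 6], ?_⟩
  ext l j
  have := hsum l
  have := h0 l
  have := h1 l
  have := h2 l
  fin_cases j <;> simp [Matrix.mul_apply, Fin.sum_univ_succ, extremalIntTetrahedron] <;> omega

theorem IsDualPair.exists_eq_mul_triangle {V : Matrix (Fin 2) (Fin 3) ℤ}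
    {U : Matrix (Fin 3) (Fin 2) ℤ} (h : IsDualPair V U (fun _ => 3) ((1 : ℕ) : ℤ))
    (hprim : ∀ j, IsPrimitivePoint fun i => V i j) (hdet : |(borderLeft 1 U).det| = 3) :
    ∃ B : Matrix (Fin 2) (Fin 2) ℤ, V = B * extremalIntTriangle := by
  have hsum : ∀ l, V l 0 + V l 1 + V l 2 = 0 := by
    intro l
    have := h.sum_mul_inv_int le_rfl (by decide) l
    simp [Fin.sum_univ_succ] at this
    have h2 : (V l 0 : ℝ) + V l 1 + V l 2 = 0 := by linarith
    exact_mod_cast h2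
  have h0 : ∀ l, (3 : ℤ) ∣ V l 0 - V l 2 := fun l =>
    h.dvd_sub le_rfl (i := 2) (j := 0) (by decide) (hprim 2) hdet (by decide) rfl l
  have h1 : ∀ l, (3 : ℤ) ∣ V l 1 - V l 2 := fun l =>
    h.dvd_sub le_rfl (i := 2) (j := 1) (by decide) (hprim 2) hdet (by decide) rfl l
  refine ⟨Matrix.of fun l => ![V l 0, (V l 1 - V l 0) / 3], ?_⟩
  ext l j
  have := hsum l
  have := h0 l
  have := h1 l
  fin_cases j <;> simp [Matrix.mul_apply, Fin.sum_univ_succ, extremalIntTriangle] <;> omega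

theorem IsPrimitivePoint.not_two_dvd {d : ℕ} {v : Fin d → ℤ} (hv : IsPrimitivePoint v) :
    ¬ ∀ k, 2 ∣ v k := by
  intro h
  choose w hw using h
  have := hv 2 w (funext hw)
  rw [Int.isUnit_iff] at this
  omega

/-- The unit fraction partition `1 / 2 = 1 / 6 + 1 / 6 + 1 / 6` does not come from a Fano triangle of
Gorenstein index two with a unimodular facet of the dual. -/
theorem IsDualPair.abs_det_ne_six {V : Matrix (Fin 2) (Fin 3) ℤ} {U : Matrix (Fin 3) (Fin 2) ℤ}
    (h : IsDualPair V U (fun _ => 6) ((2 : ℕ) : ℤ)) (hprim : ∀ j, IsPrimitivePoint fun i => V i j) :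
    |(borderLeft 1 U).det| ≠ 6 := by
  intro hdet
  have hsum : ∀ l, V l 0 + V l 1 + V l 2 = 0 := by
    intro l
    have := h.sum_mul_inv_int (by norm_num) (by decide) l
    simp [Fin.sum_univ_succ] at this
    have h2 : (V l 0 : ℝ) + V l 1 + V l 2 = 0 := by linarith
    exact_mod_cast h2
  -- `dvd_sub` would only give a congruence modulo 6 / 2 = 3. Here n ≡ 1 modulo 3, and an even n
  -- would make v_j divisible by 2, so primitivity of v_j improves the modulus to 6.
  have hcong : ∀ j : Fin 3, 2 ≠ j → ∀ l, (6 : ℤ) ∣ V l j - V l 2 := by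
    intro j hj
    obtain ⟨n, hn, hV⟩ := h.exists_dvd_sub (i := 2) (j := j) (by decide) (hprim 2) hdet hj
    rcases Int.even_or_odd n with ⟨m, rfl⟩ | ⟨m, rfl⟩
    · refine absurd (fun l => ?_) (hprim j).not_two_dvd
      have h1 : (2 : ℤ) ∣ V l j - (m + m) * V l 2 := (by norm_num : (2 : ℤ) ∣ 6).trans (hV l)
      have h2 : V l j = (V l j - (m + m) * V l 2) + 2 * (m * V l 2) := by ring
      rw [h2]
      exact dvd_add h1 (dvd_mul_right _ _)
    · intro l
      have h1 : (6 : ℤ) ∣ 2 * m := by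
        push_cast at hn
        omega
      have h2 : V l j - V l 2 = (V l j - (2 * m + 1) * V l 2) + 2 * m * V l 2 := by ring
      rw [h2]
      exact dvd_add (hV l) (h1.mul_right _)
  -- The three vertices sum to zero and agree modulo 6, so 3 v_2 is divisible by 6 and v_2 is even.
  refine (hprim 2).not_two_dvd fun l => ?_
  have h0 := hcong 0 (by decide) l
  have h1 := hcong 1 (by decide) l
  have h2 := hsum l
  omega

/-! ### The bounds and their equality cases, assembled. -/

theorem normalizedVolume_le_nine {Δ : Set (Fin 2 → ℝ)} (hΔ : IsFanoSimplex Δ)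
    (hgor : gorensteinIndex Δ = 1) :
    normalizedVolume Δ ≤ 9 ∧
      (normalizedVolume Δ = 9 → LatticeIso Δ (simplexOf extremalTriangle)) := by
  obtain ⟨V, U, A, hA, hmono, hprim, h, rfl⟩ := hΔ.exists_sorted_isDualPair le_rfl hgor
  have hs := h.sum_inv_eq hA le_rfl
  rw [Nat.cast_one, div_one] at hs
  replace hs := (Fin.sum_univ_three fun j => 1 / (A j : ℝ)).symm.trans hs
  obtain ⟨hle, heq⟩ := eq_three_of_sum_inv_eq_one (hA 0) (hmono (by decide : (0 : Fin 3) ≤ 1))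
    (hmono (by decide : (1 : Fin 3) ≤ 2)) hs
  obtain ⟨h1, h2⟩ := h.sq_mul_abs_det_le hA hprim (c := 9) (by norm_num)
    (by simpa [Fin.prod_univ_two] using hle)
  rw [normalizedVolume_toRealMatrix]
  refine ⟨?_, fun hvol => ?_⟩
  · have : |(borderTop 1 V).det| ≤ 9 := by simpa using h1
    exact_mod_cast this
  · have hvol' : |(borderTop 1 V).det| = 9 := by exact_mod_cast hvol
    obtain ⟨h3, h4⟩ := h2 (by simpa using hvol')
    obtain ⟨h5, h6, h7⟩ := heq (by simpa [Fin.prod_univ_two] using h3)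
    have hA3 : A = fun _ => 3 := by
      ext j
      fin_cases j
      exacts [h5, h6, h7]
    subst hA3
    obtain ⟨B, hB⟩ := h.exists_eq_mul_triangle hprim h4
    rw [extremalTriangle_eq]
    refine latticeIso_of_eq_mul_of_abs_det_eq hB (hvol'.trans abs_det_borderTop_triangle.symm) ?_
    rw [← abs_ne_zero, abs_det_borderTop_triangle]
    norm_num

/-- Multiplying by g² keeps the comparison within the integers. The three branches of the equality
case match the three partitions left by `mul_prod_le_of_sum_inv_eq`, and the last one is not
realised. -/
theorem sq_mul_volume_le {e g : ℕ} (hg : 1 ≤ g) (hne : ¬ (e = 0 ∧ g = 1))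
    {Δ : Set (Fin (e + 2) → ℝ)} (hΔ : IsFanoSimplex Δ) (hgor : gorensteinIndex Δ = g) :
    (g : ℝ) ^ 2 * normalizedVolume Δ ≤ 2 * truncSylvester g (e + 2) ^ 2 ∧
      ((g : ℝ) ^ 2 * normalizedVolume Δ = 2 * truncSylvester g (e + 2) ^ 2 →
        LatticeIso Δ (simplexOf extremalTetrahedron) ∨
          LatticeIso Δ (simplexOf (extremalMatrix (e + 2) g))) := by
  obtain ⟨V, U, A, hA, hmono, hprim, h, rfl⟩ := hΔ.exists_sorted_isDualPair hg hgor
  have hs := h.sum_inv_eq hA hg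
  rw [← sum_extendFin] at hs
  obtain ⟨hle, heq⟩ := mul_prod_le_of_sum_inv_eq (A := extendFin A) hg hne (fun i _ => hA _)
    (fun i j hij _ => extendFin_mono hmono i j hij) hs
  rw [prod_extendFin] at hle heq
  have ht : 1 ≤ truncSylvester g (e + 2) := truncSylvester_pos hg (e + 1)
  obtain ⟨h1, h2⟩ := h.sq_mul_abs_det_le hA hprim (c := 2 * truncSylvester g (e + 2) ^ 2)
    (by positivity) hle
  rw [normalizedVolume_toRealMatrix]
  refine ⟨by exact_mod_cast h1, fun hvol => ?_⟩
  have hvol' : g ^ 2 * |(borderTop 1 V).det| = 2 * truncSylvester g (e + 2) ^ 2 := by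
    exact_mod_cast hvol
  obtain ⟨h3, h4⟩ := h2 hvol'
  rcases heq h3 with ⟨h5, h6, h7⟩ | ⟨rfl, rfl, h5, h6, h7, h8⟩ | ⟨rfl, rfl, h5, h6, h7⟩
  · right
    have hAe : A = extremalPartition e g := by
      rw [truncSylvester_eq_mul_sylvesterProd, ← mul_assoc] at h6 h7
      ext j
      rw [← extendFin_val A j]
      refine Fin.lastCases ?_ (fun j => Fin.lastCases ?_ (fun j => ?_) j) j
      · rw [extremalPartition_last]
        exact h7
      · rw [extremalPartition_last_castSucc]
        exact h6
      · rw [extremalPartition_castSucc]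
        exact h5 j j.isLt
    subst hAe
    obtain ⟨B, hB⟩ := h.exists_eq_mul_extremal hg hprim h4
    have hg' : (0 : ℤ) < g := by exact_mod_cast hg
    rw [extremalMatrix_eq hg]
    refine latticeIso_of_eq_mul_of_abs_det_eq hB ?_ ?_
    · rw [abs_det_borderTop_extremal hg]
      refine mul_left_cancel₀ (pow_ne_zero 2 hg'.ne') ?_
      rw [hvol', truncSylvester_eq_mul_sylvesterProd]
      ring
    · rw [← abs_ne_zero, abs_det_borderTop_extremal hg]
      have := sylvesterProd_pos hg (e + 1)
      positivity
  · left
    have hA2 : A = ![2, 6, 6, 6] := by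
      ext j
      rw [← extendFin_val A j]
      fin_cases j
      exacts [h5, h6, h7, h8]
    subst hA2
    obtain ⟨B, hB⟩ := h.exists_eq_mul_tetrahedron hprim h4
    rw [extremalTetrahedron_eq]
    refine latticeIso_of_eq_mul_of_abs_det_eq hB ?_ ?_
    · rw [abs_det_borderTop_tetrahedron]
      simpa [truncSylvester, sylvester] using hvol'
    · rw [← abs_ne_zero, abs_det_borderTop_tetrahedron]
      norm_num
  · exfalso
    have hA6 : A = fun _ => 6 := by
      ext j
      rw [← extendFin_val A j]
      fin_cases j
      exacts [h5, h6, h7]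
    subst hA6
    exact h.abs_det_ne_six hprim h4

theorem theorem1p1 :
    -- the case `(d, g) = (2, 1)`
    ((IsFanoSimplex (simplexOf extremalTriangle) ∧
        gorensteinIndex (simplexOf extremalTriangle) = 1) ∧
      ∀ Δ : Set (Fin 2 → ℝ), IsFanoSimplex Δ → gorensteinIndex Δ = 1 →
        normalizedVolume Δ ≤ 9 ∧
        (normalizedVolume Δ = 9 ↔ LatticeIso Δ (simplexOf extremalTriangle))) ∧
    -- all other cases; the bound is sharp for every `(d, g)`
    (∀ d g : ℕ, 2 ≤ d → 1 ≤ g → (d, g) ≠ (2, 1) →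
      (IsFanoSimplex (simplexOf (extremalMatrix d g)) ∧
        gorensteinIndex (simplexOf (extremalMatrix d g)) = g) ∧
      ∀ Δ : Set (Fin d → ℝ), IsFanoSimplex Δ → gorensteinIndex Δ = g →
        normalizedVolume Δ ≤ 2 * (truncSylvester g d : ℝ) ^ 2 / (g : ℝ) ^ 2 ∧
        (normalizedVolume Δ = 2 * (truncSylvester g d : ℝ) ^ 2 / (g : ℝ) ^ 2 ↔
          LatticeIso Δ (simplexOf extremalTetrahedron) ∨
          LatticeIso Δ (simplexOf (extremalMatrix d g)))) ∧
    -- the sporadic simplex is a Fano simplex of dimension three and Gorenstein index one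
    (IsFanoSimplex (simplexOf extremalTetrahedron) ∧
      gorensteinIndex (simplexOf extremalTetrahedron) = 1) := by
  refine ⟨⟨⟨?_, ?_⟩, fun Δ hΔ hgor => ?_⟩, fun d g hd hg hne => ?_, ?_, ?_⟩
  · rw [extremalTriangle_eq]
    exact triangle_isDualPair.isFanoSimplex (by decide) le_rfl triangle_primitive
  · rw [extremalTriangle_eq]
    exact triangle_isDualPair.gorensteinIndex_eq (by decide) le_rfl (i := 0) (l := 0)
      (by simp [isCoprime_one_left])
  · obtain ⟨h1, h2⟩ := normalizedVolume_le_nine hΔ hgor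
    refine ⟨h1, h2, fun hiso => ?_⟩
    rw [extremalTriangle_eq] at hiso
    rw [hiso.normalizedVolume_eq, abs_det_borderTop_triangle]
    norm_num
  · obtain ⟨e, rfl⟩ : ∃ e, d = e + 2 := ⟨d - 2, by omega⟩
    have hg' : (0 : ℝ) < (g : ℝ) ^ 2 := by
      have : (0 : ℝ) < g := by exact_mod_cast hg
      positivity
    refine ⟨⟨extremal_isFanoSimplex hg e, extremal_gorensteinIndex hg e⟩, fun Δ hΔ hgor => ?_⟩
    obtain ⟨h1, h2⟩ := sq_mul_volume_le hg (by rintro ⟨rfl, rfl⟩; exact hne rfl) hΔ hgor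
    rw [le_div_iff₀ hg', eq_div_iff hg'.ne', mul_comm]
    refine ⟨h1, h2, ?_⟩
    rintro (hiso | hiso)
    -- A lattice isomorphism preserves dimension and Gorenstein index, so d = 3 and g = 1, where the
    -- bound is 2 · 6² = 72, the volume of the tetrahedron.
    · obtain rfl : e = 1 := by have := hiso.dim_eq; omega
      rw [extremalTetrahedron_eq] at hiso
      obtain rfl : g = 1 := by
        rw [← hgor]
        exact hiso.gorensteinIndex_eq_one (by norm_num) tetrahedron_isDualPair (by decide)
      rw [hiso.normalizedVolume_eq, abs_det_borderTop_tetrahedron]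
      norm_num [truncSylvester, sylvester]
    · rw [extremalMatrix_eq hg] at hiso
      rw [hiso.normalizedVolume_eq, abs_det_borderTop_extremal hg,
        truncSylvester_eq_mul_sylvesterProd]
      push_cast
      ring
  · rw [extremalTetrahedron_eq]
    exact tetrahedron_isDualPair.isFanoSimplex (by decide) le_rfl tetrahedron_primitive
  · rw [extremalTetrahedron_eq]
    exact tetrahedron_isDualPair.gorensteinIndex_eq (by decide) le_rfl (i := 0) (l := 0)
      (by simp [isCoprime_one_left])
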